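/- Let $d\in\mathbb N$, $\alpha>2d$, $m\in\mathbb N$ and $t_0>0$. There are a constant $C>0$ and, for every $\varepsilon>0$, a constant $c_\varepsilon>0$, depending only on $d,\alpha,m,t_0$ (and $c_\varepsilon$ on $\varepsilon$), such that the following holds. Let $\Lambda\subset\mathbb Z^d$ be a finite lattice with Euclidean distance $\mathrm{dist}$ and a finite-level quantum system at each site, with total Hilbert space $\mathcal H$. Call a linear map $K$ on $\mathcal B(\mathcal H)$ a (Heisenberg-picture) Liouvillian supported on $Y\subset\Lambda$ if $K(O)=i[H,O]+\sum_k\big(L_k^\dagger O L_k-\tfrac12\{L_k^\dagger L_k,O\}\big)$ for a Hermitian operator $H$ and finitely many jump operators $L_k$, all supported on $Y$. Let $\mathcal L^\dagger=\sum_{Z\subset\Lambda}\mathcal L_Z^\dagger$, where each $\mathcal L^\dagger_Z$ is a Liouvillian supported on $Z$ and, for all sites $i\neq j$ of $\Lambda$, $$\sum_{Z\ni i,j}\|\mathcal L_Z^\dagger\|_\infty\le\frac1{\mathrm{dist}(i,j)^\alpha},\qquad \|K\|_\infty:=\sup_{O\ne0}\frac{\|K(O)\|}{\|O\|},$$ with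 $\|\cdot\|$ the operator norm. Let $X,Y\subset\Lambda$ be nonempty with $|X|\le m$ and $r:=\mathrm{dist}(X,Y)>0$ ($Y$ may be arbitrarily large), let $A$ be an operator supported on $X$, let $K_Y$ be a Liouvillian supported on $Y$, and let $t\ge t_0$. Then $$\|K_Y(e^{\mathcal L^\dagger t}A)\|\le C\,\|K_Y\|_\infty\,\|A\|\,\frac{t^{\alpha-d}}{r^{\alpha-2d}} ,$$ which gives the power-law light cone $t\sim r^{\frac{\alpha-2d}{\alpha-d}}$: for every $\varepsilon>0$, if $t\le c_\varepsilon\, r^{\frac{\alpha-2d}{\alpha-d}}$, then $\|K_Y(e^{\mathcal L^\dagger t}A)\|\le\varepsilon\,\|K_Y\|_\infty\,\|A\|$. -/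

import Mathlib

open scoped Matrix.Norms.L2Operator

/-- Euclidean distance between two sites of the cubic lattice `ℤ^d`. -/
noncomputable def siteDist {d : ℕ} (x y : Fin d → ℤ) : ℝ :=
  Real.sqrt (∑ k, ((x k : ℝ) - (y k : ℝ)) ^ 2)

/-- `r` is the distance `min {dist x y | x ∈ X, y ∈ Y}` between two sets of sites of the finite
lattice `Λ`; in particular both sets are nonempty. -/
def IsSetDist {d : ℕ} {Λ : Finset (Fin d → ℤ)} (X Y : Finset Λ) (r : ℝ) : Prop :=
  IsLeast {s : ℝ | ∃ x ∈ X, ∃ y ∈ Y, s = siteDist (x : Fin d → ℤ) (y : Fin d → ℤ)} r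

section System

variable {V : Type} [Fintype V] [DecidableEq V]

/-- Labels of the product basis of `⨂_{i ∈ V} ℂ^(q i)`, where site `i` is a `q i`-level system. -/
abbrev BasisState (q : V → ℕ) : Type := (i : V) → Fin (q i)

/-- `𝓑(𝓗)` for `𝓗 = ⨂_{i ∈ V} ℂ^(q i)`, in the product basis. The norm is the standard operator
norm (induced by the Hilbert space norm of `𝓗`). -/
abbrev Obs (q : V → ℕ) : Type := Matrix (BasisState q) (BasisState q) ℂ

/-- Superoperators: linear maps of `𝓑(𝓗)`. The norm is the `∞ → ∞` norm, that is, the smallest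
`c ≥ 0` with `‖K O‖ ≤ c ‖O‖` for all `O` in `𝓑(𝓗)`. -/
abbrev SuperOp (q : V → ℕ) : Type := Obs q →L[ℂ] Obs q

/-- The operator `a ⊗ 𝟙` of `𝓑(𝓗)`, where `a` acts on the sites in `X`
and `𝟙` on all the others. -/
def embedObs (q : V → ℕ) (X : Finset V)
    (a : Matrix ((i : X) → Fin (q i)) ((i : X) → Fin (q i)) ℂ) : Obs q :=
  fun s s' => if ∀ i, i ∉ X → s i = s' i then a (fun i => s i) (fun i => s' i) else 0

/-- `A` is supported on `X`. -/
def SupportedOn {q : V → ℕ} (X : Finset V) (A : Obs q) : Prop :=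
  ∃ a, A = embedObs q X a

/-- `K` is a Liouvillian supported on `Y`, in the Heisenberg picture (adjoint Lindblad form):
`K O = i[H, O] + ∑ₖ (Lₖ† O Lₖ - ½ {Lₖ† Lₖ, O})`, with a Hamiltonian `H` and jump operators `Lₖ`
supported on `Y`. -/
def IsLiouvillianOn {q : V → ℕ} (Y : Finset V) (K : SuperOp q) : Prop :=
  ∃ (H : Obs q) (n : ℕ) (J : Fin n → Obs q),
    H.IsHermitian ∧ SupportedOn Y H ∧ (∀ k, SupportedOn Y (J k)) ∧
    ∀ O : Obs q, K O = Complex.I • (H * O - O * H) +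
      ∑ k, ((J k).conjTranspose * O * J k -
        (1 / 2 : ℂ) • ((J k).conjTranspose * J k * O + O * ((J k).conjTranspose * J k)))

/-- The Heisenberg evolution `e^(t 𝓛†)` generated by `𝓛† = ∑_{Z ⊆ V} 𝓛†_Z`. -/
noncomputable def heisenbergEvolution {q : V → ℕ} (L : Finset V → SuperOp q) (t : ℝ) : SuperOp q :=
  NormedSpace.exp ((t : ℂ) • ∑ Z, L Z)

end System

/-- The family `Z ↦ 𝓛†_Z` is an open system on the finite lattice `Λ` with power-law interactions
of exponent `α`: every `𝓛†_Z` is a Liouvillian supported on `Z`, and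
`∑_{Z ∋ i, j} ‖𝓛†_Z‖ ≤ 1 / dist(i, j)^α` for every pair of distinct sites. -/
def IsLongRange {d : ℕ} {Λ : Finset (Fin d → ℤ)} {q : Λ → ℕ} (α : ℝ)
    (L : Finset Λ → SuperOp q) : Prop :=
  (∀ Z, IsLiouvillianOn Z (L Z)) ∧
  ∀ i j : Λ, i ≠ j →
    ∑ Z : Finset Λ with i ∈ Z ∧ j ∈ Z, ‖L Z‖ ≤
      1 / siteDist (i : Fin d → ℤ) (j : Fin d → ℤ) ^ α

/-! A local Liouvillian annihilates every observable that commutes with all operators on its support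
(`IsLiouvillianOn.apply_eq_zero`). So it suffices to approximate `e^(t𝓛†) A` by some `B` acting
trivially on `Y`: then `K_Y` sees only the error, and the size of `Y` never enters.

Short times. Let the influence of site `i` on `O` be the norm of `O` minus its compression at `i`.
Compare the full evolution by Duhamel with the one in which the terms joining `i` to other sites are
dropped. The dropped terms are controlled by the influences of the other sites, and the kernel `F ∼
dist^(-α)` satisfies `F * F ≤ p F`, so the profile `∑_{l ∈ S} F i l` reproduces itself. Up to a
fixed time `τ` this gives influence at most `8 ‖A‖ ∑_{l ∈ S} F i l` for `A` living on `S`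
(`influence_heisenbergEvolution_le`). Contractivity of all the semigroups is used throughout; it
follows from the Kraus form of `1 + εK` up to `O(ε²)`.

Long times. Cut `t` into `n ∼ t` slices and, after each, compress the observable to a neighbourhood
of `X` that grows by `l = r/(2n)`. The errors add up to a sum of `F` over pairs of sites separated
by a layer (`exists_trivialOn_norm_pow_sub_le`). Bounding each layer separately would give `n r^d
l^(d-α)`. But a pair at distance `D` straddles at most `D/l` layers, so the total is at most of
order `r^d l^(-1) ∑_{D > l} D^(1-α) ∼ r^d l^(d-α)`, which saves a factor `n` (`sum_layers_le`). With
`l ∼ r/t` this is `t^(α-d) / r^(α-2d)`. The tail sum converges because `α - 1 > d`, which follows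
from `α > 2d` and `d ≥ 1`. -/

set_option linter.unusedSectionVars false

/-! ### Algebra of local operators in the product basis -/

section Embedding

variable {V : Type} [Fintype V] [DecidableEq V] {q : V → ℕ}

/-- The configuration equal to `c` on `X` and to `s` off `X`. -/
def glue (X : Finset V) (c : (i : X) → Fin (q i)) (s : BasisState q) : BasisState q :=
  fun i => if h : i ∈ X then c ⟨i, h⟩ else s i

lemma glue_of_mem {X : Finset V} (c : (i : X) → Fin (q i)) (s : BasisState q) (i : X) :
    glue X c s i = c i := by
  simp [glue]

lemma glue_of_notMem {X : Finset V} (c : (i : X) → Fin (q i)) (s : BasisState q) {i : V}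
    (h : i ∉ X) : glue X c s i = s i := by
  simp [glue, h]

lemma embedObs_mul (X : Finset V) (a b : Matrix ((i : X) → Fin (q i)) ((i : X) → Fin (q i)) ℂ) :
    embedObs q X (a * b) = embedObs q X a * embedObs q X b := by
  ext s s'
  rw [Matrix.mul_apply]
  simp only [embedObs]
  split_ifs with h
  · rw [Matrix.mul_apply]
    refine Finset.sum_of_injOn (fun c => glue X c s) ?_ ?_ ?_ ?_
    · intro c _ c' _ hcc
      funext i
      have := congrFun hcc i
      simpa only [glue_of_mem] using this
    · intro c _; simp
    · intro u _ hu
      by_cases h1 : ∀ i, i ∉ X → s i = u i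
      · refine absurd ⟨fun i => u i, by simp, ?_⟩ hu
        funext i
        by_cases hi : i ∈ X
        · exact glue_of_mem (fun i : X => u i) s ⟨i, hi⟩
        · exact (glue_of_notMem _ _ hi).trans (h1 i hi)
      · rw [if_neg h1, zero_mul]
    · intro c _
      rw [if_pos, if_pos]
      · simp only [glue_of_mem]
      · intro i hi; rw [glue_of_notMem _ _ hi, h i hi]
      · intro i hi; rw [glue_of_notMem _ _ hi]
  · refine (Finset.sum_eq_zero fun u _ => ?_).symm
    by_cases h1 : ∀ i, i ∉ X → s i = u i
    · have h2 : ¬ ∀ i, i ∉ X → u i = s' i := fun h2 => h fun i hi => (h1 i hi).trans (h2 i hi)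
      rw [if_neg h2, mul_zero]
    · rw [if_neg h1, zero_mul]

lemma embedObs_one (X : Finset V) : embedObs q X 1 = 1 := by
  ext s s'
  simp only [embedObs, Matrix.one_apply]
  by_cases h : s = s'
  · simp [h]
  · rw [if_neg h]
    split_ifs with h1 h2
    · refine absurd (funext fun i => ?_) h
      by_cases hi : i ∈ X
      · exact congrFun h2 ⟨i, hi⟩
      · exact h1 i hi
    · rfl
    · rfl

lemma embedObs_conjTranspose (X : Finset V)
    (a : Matrix ((i : X) → Fin (q i)) ((i : X) → Fin (q i)) ℂ) :
    (embedObs q X a).conjTranspose = embedObs q X a.conjTranspose := by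
  ext s s'
  simp only [embedObs, Matrix.conjTranspose_apply]
  by_cases h : ∀ i, i ∉ X → s i = s' i
  · rw [if_pos h, if_pos fun i hi => (h i hi).symm]
  · rw [if_neg h, if_neg fun h' => h fun i hi => (h' i hi).symm, star_zero]

lemma embedObs_add (X : Finset V) (a b : Matrix ((i : X) → Fin (q i)) ((i : X) → Fin (q i)) ℂ) :
    embedObs q X (a + b) = embedObs q X a + embedObs q X b := by
  ext s s'
  simp only [embedObs, Matrix.add_apply]
  split_ifs <;> simp

lemma embedObs_zero (X : Finset V) : embedObs q X 0 = 0 := by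
  ext s s'
  simp [embedObs]

lemma embedObs_sum {ι : Type*} (X : Finset V) (t : Finset ι)
    (a : ι → Matrix ((i : X) → Fin (q i)) ((i : X) → Fin (q i)) ℂ) :
    embedObs q X (∑ k ∈ t, a k) = ∑ k ∈ t, embedObs q X (a k) := by
  classical
  induction t using Finset.induction_on with
  | empty => simp [embedObs_zero]
  | insert k t hk ih => rw [Finset.sum_insert hk, Finset.sum_insert hk, embedObs_add, ih]

lemma embedObs_mul_embedObs_apply {X Y : Finset V} (hXY : Disjoint X Y)
    (a : Matrix ((i : X) → Fin (q i)) ((i : X) → Fin (q i)) ℂ)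
    (b : Matrix ((i : Y) → Fin (q i)) ((i : Y) → Fin (q i)) ℂ) (s s' : BasisState q) :
    (embedObs q X a * embedObs q Y b) s s' = if ∀ i, i ∉ X → i ∉ Y → s i = s' i then
      a (fun i => s i) (fun i => s' i) * b (fun i => s i) (fun i => s' i) else 0 := by
  have hY : ∀ i : Y, (i : V) ∉ X := fun i hi => Finset.disjoint_left.mp hXY hi i.2
  rw [Matrix.mul_apply]
  simp only [embedObs]
  -- The first factor fixes the intermediate configuration off `X`, the second fixes it off `Y`,
  -- hence on `X`; only one term survives.
  rw [Finset.sum_eq_single (glue X (fun i => s' i) s)]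
  · by_cases h : ∀ i, i ∉ X → i ∉ Y → s i = s' i
    · rw [if_pos h, if_pos, if_pos]
      · simp only [glue_of_mem, glue_of_notMem _ _ (hY _)]
      · intro i hi
        by_cases hX : i ∈ X
        · exact glue_of_mem (fun i : X => s' i) s ⟨i, hX⟩
        · rw [glue_of_notMem _ _ hX, h i hX hi]
      · intro i hi; rw [glue_of_notMem _ _ hi]
    · rw [if_neg h, if_neg (c := ∀ i, i ∉ Y → _), mul_zero]
      intro h'
      refine h fun i hX hYi => ?_
      rw [← h' i hYi, glue_of_notMem _ _ hX]
  · intro u _ hu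
    by_cases h1 : ∀ i, i ∉ X → s i = u i
    · rw [if_neg (c := ∀ i, i ∉ Y → _), mul_zero]
      intro h2
      refine hu (funext fun i => ?_)
      by_cases hX : i ∈ X
      · rw [h2 i (Finset.disjoint_left.mp hXY hX)]
        exact (glue_of_mem (fun i : X => s' i) s ⟨i, hX⟩).symm
      · rw [glue_of_notMem _ _ hX, h1 i hX]
    · rw [if_neg h1, zero_mul]
  · simp

lemma embedObs_commute {X Y : Finset V} (hXY : Disjoint X Y)
    (a : Matrix ((i : X) → Fin (q i)) ((i : X) → Fin (q i)) ℂ)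
    (b : Matrix ((i : Y) → Fin (q i)) ((i : Y) → Fin (q i)) ℂ) :
    Commute (embedObs q X a) (embedObs q Y b) := by
  refine Matrix.ext fun s s' => ?_
  rw [embedObs_mul_embedObs_apply hXY, embedObs_mul_embedObs_apply hXY.symm, mul_comm]
  have : (∀ i, i ∉ X → i ∉ Y → s i = s' i) ↔ (∀ i, i ∉ Y → i ∉ X → s i = s' i) := by
    constructor <;> exact fun h i h1 h2 => h i h2 h1
  simp only [this]

lemma SupportedOn.mono {X Y : Finset V} (hXY : X ⊆ Y) {A : Obs q} (hA : SupportedOn X A) :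
    SupportedOn Y A := by
  obtain ⟨a, rfl⟩ := hA
  refine ⟨fun u u' => if ∀ i : Y, (i : V) ∉ X → u i = u' i then
    a (fun i => u ⟨i, hXY i.2⟩) (fun i => u' ⟨i, hXY i.2⟩) else 0, ?_⟩
  ext s s'
  simp only [embedObs]
  by_cases h : ∀ i, i ∉ X → s i = s' i
  · rw [if_pos h, if_pos fun i hi => h i fun hX => hi (hXY hX), if_pos fun (i : Y) hi => h i hi]
  · rw [if_neg h]
    split_ifs with h1 h2
    · refine absurd (fun i hi => ?_) h
      by_cases hY : i ∈ Y
      · exact h2 ⟨i, hY⟩ hi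
      · exact h1 i hY
    · rfl
    · rfl

end Embedding

/-! ### Commutants of local algebras and the action of Liouvillians on them -/

section Commutant

variable {V : Type} [Fintype V] [DecidableEq V] {q : V → ℕ}

/-- The observables commuting with every observable supported on `S`: they act trivially on `S`. -/
def TrivialOn (S : Finset V) (O : Obs q) : Prop :=
  ∀ b, SupportedOn S b → Commute O b

lemma SupportedOn.trivialOn {X S : Finset V} (h : Disjoint X S) {A : Obs q}
    (hA : SupportedOn X A) : TrivialOn S A := by
  rintro _ ⟨b, rfl⟩
  obtain ⟨a, rfl⟩ := hA
  exact embedObs_commute h a b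

lemma TrivialOn.anti {S T : Finset V} (h : S ⊆ T) {O : Obs q} (hO : TrivialOn T O) :
    TrivialOn S O := fun b hb => hO b (hb.mono h)

lemma SupportedOn.conjTranspose {X : Finset V} {A : Obs q} (hA : SupportedOn X A) :
    SupportedOn X A.conjTranspose := by
  obtain ⟨a, rfl⟩ := hA
  exact ⟨_, embedObs_conjTranspose X a⟩

lemma TrivialOn.conjTranspose {S : Finset V} {O : Obs q} (hO : TrivialOn S O) :
    TrivialOn S O.conjTranspose := by
  intro b hb
  have := congrArg Matrix.conjTranspose (hO _ hb.conjTranspose)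
  simp only [Matrix.conjTranspose_mul, Matrix.conjTranspose_conjTranspose] at this
  exact this.symm

lemma TrivialOn.mul {S : Finset V} {O O' : Obs q} (hO : TrivialOn S O) (hO' : TrivialOn S O') :
    TrivialOn S (O * O') := fun b hb => (hO b hb).mul_left (hO' b hb)

lemma TrivialOn.add {S : Finset V} {O O' : Obs q} (hO : TrivialOn S O) (hO' : TrivialOn S O') :
    TrivialOn S (O + O') := fun b hb => (hO b hb).add_left (hO' b hb)

lemma TrivialOn.sub {S : Finset V} {O O' : Obs q} (hO : TrivialOn S O) (hO' : TrivialOn S O') :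
    TrivialOn S (O - O') := fun b hb => (hO b hb).sub_left (hO' b hb)

lemma TrivialOn.smul {S : Finset V} {O : Obs q} (c : ℂ) (hO : TrivialOn S O) :
    TrivialOn S (c • O) := fun b hb => (hO b hb).smul_left c

lemma TrivialOn.sum {ι : Type*} {S : Finset V} (t : Finset ι) {f : ι → Obs q}
    (h : ∀ k ∈ t, TrivialOn S (f k)) : TrivialOn S (∑ k ∈ t, f k) :=
  fun b hb => Commute.sum_left _ _ _ fun k hk => h k hk b hb

lemma isClosed_trivialOn (S : Finset V) : IsClosed {O : Obs q | TrivialOn S O} := by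
  have : {O : Obs q | TrivialOn S O} = ⋂ b, ⋂ (_ : SupportedOn S b), {O | O * b = b * O} := by
    ext O; simp [TrivialOn, Commute, SemiconjBy]
  rw [this]
  exact isClosed_iInter fun b => isClosed_iInter fun _ =>
    isClosed_eq (continuous_id.mul continuous_const) (continuous_const.mul continuous_id)

/-- A Liouvillian on `Y` annihilates the observables acting trivially on `Y`. -/
lemma IsLiouvillianOn.apply_eq_zero {Y : Finset V} {K : SuperOp q} (hK : IsLiouvillianOn Y K)
    {O : Obs q} (hO : TrivialOn Y O) : K O = 0 := by
  obtain ⟨H, n, J, -, hH, hJ, h⟩ := hK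
  rw [h, (hO H hH).eq, sub_self, smul_zero, zero_add]
  refine Finset.sum_eq_zero fun k _ => ?_
  have h1 : O * J k = J k * O := hO _ (hJ k)
  have h2 : O * (J k).conjTranspose = (J k).conjTranspose * O := hO _ (hJ k).conjTranspose
  have h3 : O * ((J k).conjTranspose * J k) = (J k).conjTranspose * J k * O := by
    rw [← mul_assoc, h2, mul_assoc, h1, mul_assoc]
  rw [h3, mul_assoc, h1, mul_assoc, ← two_smul ℂ, smul_smul]
  norm_num

/-- A Liouvillian supported away from `S` preserves triviality on `S`. -/
lemma IsLiouvillianOn.trivialOn {Z S : Finset V} (hZS : Disjoint Z S) {K : SuperOp q}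
    (hK : IsLiouvillianOn Z K) {O : Obs q} (hO : TrivialOn S O) : TrivialOn S (K O) := by
  obtain ⟨H, n, J, -, hH, hJ, h⟩ := hK
  have hH := hH.trivialOn hZS
  have hJ := fun k => (hJ k).trivialOn hZS
  rw [h]
  refine (((hH.mul hO).sub (hO.mul hH)).smul _).add (TrivialOn.sum _ fun k _ => ?_)
  have hN := (hJ k).conjTranspose.mul (hJ k)
  exact (((hJ k).conjTranspose.mul hO).mul (hJ k)).sub (((hN.mul hO).add (hO.mul hN)).smul _)

end Commutant

/-! ### Norms of completely positive maps -/

section Kraus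

/-- Test against unit vectors `u`, `v`: the matrix element is at most `‖O‖ ∑ ‖T k u‖ ‖T k v‖`. By
the inequality of arithmetic and geometric means, only `∑ ‖T k u‖² = ⟨u, N u⟩ ≤ ‖N‖` and its
analogue for `v` are needed. -/
lemma norm_sum_adjoint_comp_comp_le {ι E : Type*} [Fintype ι] [NormedAddCommGroup E]
    [InnerProductSpace ℂ E] [CompleteSpace E] (T : ι → E →L[ℂ] E) (O : E →L[ℂ] E) :
    ‖∑ k, star (T k) * O * T k‖ ≤ ‖∑ k, star (T k) * T k‖ * ‖O‖ := by
  set N := ∑ k, star (T k) * T k with hN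
  have key : ∀ u : E, ∑ k, ‖T k u‖ ^ 2 ≤ ‖N‖ * ‖u‖ ^ 2 := by
    intro u
    have h1 : ((∑ k, ‖T k u‖ ^ 2 : ℝ) : ℂ) = inner ℂ u (N u) := by
      rw [hN, sum_apply, inner_sum]
      push_cast
      refine Finset.sum_congr rfl fun k _ => ?_
      change _ = inner ℂ u (star (T k) (T k u))
      rw [ContinuousLinearMap.star_eq_adjoint,
        ContinuousLinearMap.adjoint_inner_right, inner_self_eq_norm_sq_to_K]
      rfl
    have h2 : ‖((∑ k, ‖T k u‖ ^ 2 : ℝ) : ℂ)‖ ≤ ‖N‖ * ‖u‖ ^ 2 := by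
      rw [h1]
      calc _ ≤ ‖u‖ * ‖N u‖ := norm_inner_le_norm _ _
        _ ≤ ‖u‖ * (‖N‖ * ‖u‖) := by gcongr; exact N.le_opNorm u
        _ = _ := by ring
    rw [Complex.norm_real] at h2
    exact (le_abs_self _).trans h2
  refine ContinuousLinearMap.opNorm_le_of_re_inner_le (by positivity) fun u v hu hv => ?_
  have h1 : inner ℂ ((∑ k, star (T k) * O * T k) u) v = ∑ k, inner ℂ (O (T k u)) (T k v) := by
    rw [sum_apply, sum_inner]
    refine Finset.sum_congr rfl fun k _ => ?_
    change inner ℂ (star (T k) (O (T k u))) v = _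
    rw [ContinuousLinearMap.star_eq_adjoint, ContinuousLinearMap.adjoint_inner_left]
  rw [h1]
  have hu' := key u
  have hv' := key v
  rw [hu, one_pow, mul_one] at hu'
  rw [hv, one_pow, mul_one] at hv'
  calc _ ≤ ‖∑ k, inner ℂ (O (T k u)) (T k v)‖ := Complex.re_le_norm _
    _ ≤ ∑ k, ‖O‖ * (‖T k u‖ * ‖T k v‖) := by
        refine norm_sum_le_of_le _ fun k _ => (norm_inner_le_norm _ _).trans ?_
        rw [← mul_assoc]
        gcongr
        exact O.le_opNorm _
    _ = ‖O‖ * ∑ k, ‖T k u‖ * ‖T k v‖ := by rw [Finset.mul_sum]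
    _ ≤ ‖O‖ * ∑ k, (‖T k u‖ ^ 2 + ‖T k v‖ ^ 2) / 2 := by
        gcongr with k
        nlinarith [sq_nonneg (‖T k u‖ - ‖T k v‖)]
    _ ≤ ‖O‖ * ‖N‖ := by
        rw [← Finset.sum_div, Finset.sum_add_distrib]
        gcongr
        linarith
    _ = _ := mul_comm _ _

variable {n ι : Type*} [Fintype n] [DecidableEq n] [Fintype ι]

/-- The norm bound for completely positive maps in Kraus form. -/
lemma norm_sum_conjTranspose_mul_mul_le (T : ι → Matrix n n ℂ) (O : Matrix n n ℂ) :
    ‖∑ k, (T k).conjTranspose * O * T k‖ ≤ ‖∑ k, (T k).conjTranspose * T k‖ * ‖O‖ := by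
  have := norm_sum_adjoint_comp_comp_le
    (fun k => Matrix.toEuclideanCLM (n := n) (𝕜 := ℂ) (T k)) (Matrix.toEuclideanCLM (𝕜 := ℂ) O)
  simpa only [← map_star, ← map_mul, ← map_sum, ← Matrix.cstar_norm_def,
    Matrix.star_eq_conjTranspose] using this

lemma norm_one_matrix_le : ‖(1 : Matrix n n ℂ)‖ ≤ 1 := by
  rw [Matrix.cstar_norm_def, map_one]
  exact ContinuousLinearMap.norm_id_le

end Kraus

/-! ### Contraction semigroups and Duhamel's formula -/

section Dissipative

open Filter Topology

variable {E : Type*} [NormedAddCommGroup E] [NormedSpace ℂ E]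

/-- Generators of contraction semigroups: the logarithmic norm is nonpositive. -/
def IsDissipative (G : E →L[ℂ] E) : Prop :=
  ∀ η : ℝ, 0 < η → ∀ᶠ ε : ℝ in 𝓝[>] 0, ‖1 + (ε : ℂ) • G‖ ≤ 1 + η * ε

lemma isDissipative_zero : IsDissipative (0 : E →L[ℂ] E) := by
  intro η hη
  filter_upwards [self_mem_nhdsWithin] with ε hε
  rw [smul_zero, add_zero]
  have : 0 < η * ε := mul_pos hη hε
  have h1 : ‖(1 : E →L[ℂ] E)‖ ≤ 1 := ContinuousLinearMap.norm_id_le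
  linarith

lemma tendsto_const_mul_nhdsGT_zero {c : ℝ} (hc : 0 < c) :
    Tendsto (fun ε : ℝ => c * ε) (𝓝[>] 0) (𝓝[>] 0) := by
  refine tendsto_nhdsWithin_iff.mpr ⟨?_, ?_⟩
  · have : Tendsto (fun ε : ℝ => c * ε) (𝓝 0) (𝓝 (c * 0)) :=
      Continuous.tendsto (by fun_prop) 0
    rw [mul_zero] at this
    exact this.mono_left nhdsWithin_le_nhds
  · filter_upwards [self_mem_nhdsWithin] with ε hε using mul_pos hc hε

/-- `1 + ε(G + G')` is the average of `1 + 2εG` and `1 + 2εG'`. -/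
lemma IsDissipative.add {G G' : E →L[ℂ] E} (h : IsDissipative G) (h' : IsDissipative G') :
    IsDissipative (G + G') := by
  intro η hη
  have ht := tendsto_const_mul_nhdsGT_zero (c := 2) two_pos
  filter_upwards [ht.eventually (h (η / 2) (half_pos hη)),
    ht.eventually (h' (η / 2) (half_pos hη))] with ε h1 h2
  have : 1 + (ε : ℂ) • (G + G') = (1 / 2 : ℂ) • ((1 + ((2 * ε : ℝ) : ℂ) • G) +
      (1 + ((2 * ε : ℝ) : ℂ) • G')) := by
    push_cast
    module
  rw [this, norm_smul]
  have h3 := norm_add_le (1 + ((2 * ε : ℝ) : ℂ) • G) (1 + ((2 * ε : ℝ) : ℂ) • G')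
  have h4 : ‖(1 / 2 : ℂ)‖ = 1 / 2 := by norm_num
  rw [h4]
  linarith

lemma isDissipative_sum {ι : Type*} (t : Finset ι) {G : ι → E →L[ℂ] E}
    (h : ∀ k ∈ t, IsDissipative (G k)) : IsDissipative (∑ k ∈ t, G k) := by
  classical
  induction t using Finset.induction_on with
  | empty => simpa using isDissipative_zero
  | insert k t hk ih =>
    rw [Finset.sum_insert hk]
    exact (h k (Finset.mem_insert_self _ _)).add
      (ih fun l hl => h l (Finset.mem_insert_of_mem hl))

variable [CompleteSpace E]

lemma hasDerivAt_exp_ofReal_smul (G : E →L[ℂ] E) (t : ℝ) :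
    HasDerivAt (fun s : ℝ => NormedSpace.exp ((s : ℂ) • G))
      (NormedSpace.exp ((t : ℂ) • G) * G) t := by
  convert! (hasDerivAt_exp_smul_const (𝕂 := ℂ) G (t : ℂ)).scomp t
    Complex.ofRealCLM.hasDerivAt using 1
  simp

/-- For small `ε`, `exp(εG)` differs from `1 + εG` by at most `ηε`, so its norm is at most `1 +
2ηε`. Raising the step `ε = t/(n+1)` to the power `n+1` gives `exp(2ηt)`, and `η` is arbitrary. -/
lemma IsDissipative.norm_exp_le {G : E →L[ℂ] E} (h : IsDissipative G) {t : ℝ} (ht : 0 ≤ t) :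
    ‖NormedSpace.exp ((t : ℂ) • G)‖ ≤ 1 := by
  have one_le : ‖(1 : E →L[ℂ] E)‖ ≤ 1 := ContinuousLinearMap.norm_id_le
  rcases ht.eq_or_lt with rfl | ht
  · simpa using one_le
  have key : ∀ η : ℝ, 0 < η → ‖NormedSpace.exp ((t : ℂ) • G)‖ ≤ Real.exp (2 * η * t) := by
    intro η hη
    have hd := (hasDerivAt_exp_ofReal_smul G 0).isLittleO.def hη
    have h1 : ∀ᶠ ε : ℝ in 𝓝[>] 0, ‖NormedSpace.exp ((ε : ℂ) • G)‖ ≤ 1 + 2 * η * ε := by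
      filter_upwards [h η hη, hd.filter_mono nhdsWithin_le_nhds, self_mem_nhdsWithin]
        with ε h1 h2 h3
      have h3 : 0 < ε := h3
      simp only [Complex.ofReal_zero, zero_smul, NormedSpace.exp_zero, one_mul, sub_zero,
        Real.norm_eq_abs, abs_of_pos h3] at h2
      have h4 : NormedSpace.exp ((ε : ℂ) • G) = (NormedSpace.exp ((ε : ℂ) • G) - 1 - ε • G) +
          (1 + (ε : ℂ) • G) := by
        rw [Complex.coe_smul]; abel
      rw [h4]
      refine (norm_add_le _ _).trans ?_
      linarith
    have h2 : Tendsto (fun n : ℕ => t / ((n : ℝ) + 1)) atTop (𝓝[>] 0) := by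
      refine tendsto_nhdsWithin_iff.mpr ⟨?_, Eventually.of_forall fun n => ?_⟩
      · have := tendsto_one_div_add_atTop_nhds_zero_nat (𝕜 := ℝ)
        simpa [div_eq_mul_inv] using this.const_mul t
      · exact div_pos ht (by positivity)
    obtain ⟨n, hn⟩ := (h2.eventually h1).exists
    have hn0 : (0 : ℝ) < (n : ℝ) + 1 := by positivity
    have h3 : (t : ℂ) • G = (n + 1) • (((t / ((n : ℝ) + 1) : ℝ) : ℂ) • G) := by
      rw [← Nat.cast_smul_eq_nsmul ℂ, smul_smul]
      congr 1
      have : ((n : ℂ) + 1) ≠ 0 := by exact_mod_cast hn0.ne'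
      push_cast
      field_simp
    let : NormedAlgebra ℚ (E →L[ℂ] E) := NormedAlgebra.restrictScalars ℚ ℂ (E →L[ℂ] E)
    rw [h3, NormedSpace.exp_nsmul]
    calc _ ≤ ‖NormedSpace.exp (((t / ((n : ℝ) + 1) : ℝ) : ℂ) • G)‖ ^ (n + 1) :=
          norm_pow_le' _ n.succ_pos
      _ ≤ (1 + 2 * η * (t / ((n : ℝ) + 1))) ^ (n + 1) := by gcongr
      _ ≤ Real.exp (2 * η * (t / ((n : ℝ) + 1))) ^ (n + 1) := by
          gcongr
          rw [add_comm]
          exact Real.add_one_le_exp _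
      _ = Real.exp (2 * η * t) := by
          rw [← Real.exp_nat_mul]
          congr 1
          push_cast
          field_simp
  have h5 : Tendsto (fun η : ℝ => Real.exp (2 * η * t)) (𝓝[>] 0) (𝓝 1) := by
    have : Tendsto (fun η : ℝ => Real.exp (2 * η * t)) (𝓝 0) (𝓝 (Real.exp (2 * 0 * t))) :=
      Continuous.tendsto (by fun_prop) 0
    simp only [mul_zero, zero_mul, Real.exp_zero] at this
    exact this.mono_left nhdsWithin_le_nhds
  exact ge_of_tendsto h5 (by filter_upwards [self_mem_nhdsWithin] with η hη using key η hη)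

/-- Duhamel estimate: the evolutions under `L` and under a dissipative `G` differ by at most the
time integral of `‖(L - G) e^(sL) A‖`. -/
lemma norm_exp_apply_sub_exp_apply_le {L G : E →L[ℂ] E} (hG : IsDissipative G) (A : E) {t c : ℝ}
    (ht : 0 ≤ t) (hc : ∀ s ∈ Set.Icc 0 t, ‖(L - G) (NormedSpace.exp ((s : ℂ) • L) A)‖ ≤ c) :
    ‖NormedSpace.exp ((t : ℂ) • L) A - NormedSpace.exp ((t : ℂ) • G) A‖ ≤ c * t := by
  -- Interpolate by `s ↦ e^((t-s)G) e^(sL) A`. Its derivative has `L - G` in the middle, and the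
  -- outer factor is a contraction.
  have hd : ∀ s : ℝ, HasDerivAt (fun s : ℝ => (NormedSpace.exp (((t - s : ℝ) : ℂ) • G) *
      NormedSpace.exp ((s : ℂ) • L)) A) (NormedSpace.exp (((t - s : ℝ) : ℂ) • G)
        ((L - G) (NormedSpace.exp ((s : ℂ) • L) A))) s := by
    intro s
    have h1 : HasDerivAt (fun s : ℝ => NormedSpace.exp (((t - s : ℝ) : ℂ) • G)) _ s :=
      (hasDerivAt_exp_ofReal_smul G (t - s)).scomp s ((hasDerivAt_id s).const_sub t)
    have h2 : HasDerivAt (fun s : ℝ => NormedSpace.exp ((s : ℂ) • L))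
        (L * NormedSpace.exp ((s : ℂ) • L)) s := by
      convert! (hasDerivAt_exp_smul_const' (𝕂 := ℂ) L (s : ℂ)).scomp s
        Complex.ofRealCLM.hasDerivAt using 1
      simp
    have h3 := ((ContinuousLinearMap.apply ℂ E A).restrictScalars ℝ).hasFDerivAt.comp_hasDerivAt s
      (h1.mul h2)
    convert! h3 using 1
    simp [sub_eq_add_neg, add_comm]
  have := norm_image_sub_le_of_norm_deriv_le_segment' (a := 0) (b := t) (C := c)
    (fun s _ => (hd s).hasDerivWithinAt) (fun s hs => ?_) t ⟨ht, le_rfl⟩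
  · simpa using this
  · refine (ContinuousLinearMap.le_opNorm _ _).trans ?_
    have h1 := hG.norm_exp_le (sub_nonneg.mpr hs.2.le)
    have h2 := hc s ⟨hs.1, hs.2.le⟩
    calc _ ≤ 1 * c := mul_le_mul h1 h2 (norm_nonneg _) zero_le_one
      _ = c := one_mul c

lemma exp_nat_mul_smul (G : E →L[ℂ] E) (n : ℕ) (τ : ℝ) :
    NormedSpace.exp (((n * τ : ℝ) : ℂ) • G) = NormedSpace.exp ((τ : ℂ) • G) ^ n := by
  let : NormedAlgebra ℚ (E →L[ℂ] E) := NormedAlgebra.restrictScalars ℚ ℂ (E →L[ℂ] E)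
  rw [← NormedSpace.exp_nsmul, ← Nat.cast_smul_eq_nsmul ℂ, smul_smul]
  push_cast
  rfl

/-- The partial sums of the exponential series stay in the invariant subspace, which is closed. -/
lemma exp_apply_mem {p : Submodule ℂ E} (hp : IsClosed (p : Set E)) {G : E →L[ℂ] E}
    (hG : ∀ O ∈ p, G O ∈ p) (c : ℂ) {O : E} (hO : O ∈ p) : NormedSpace.exp (c • G) O ∈ p := by
  have h1 := (NormedSpace.exp_series_hasSum_exp' (𝕂 := ℂ) (c • G)).mapL
    (ContinuousLinearMap.apply ℂ E O)
  refine hp.mem_of_tendsto h1 (Eventually.of_forall fun s => p.sum_mem fun n _ => ?_)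
  have h2 : ∀ n : ℕ, ((c • G) ^ n) O ∈ p := by
    intro n
    induction n with
    | zero => simpa using hO
    | succ n ih =>
      rw [pow_succ']
      exact p.smul_mem c (hG _ ih)
  simpa using p.smul_mem _ (h2 n)

end Dissipative

/-! ### Liouvillians generate contractions -/

section LiouvillianDissipative

open Filter Topology

variable {V : Type} [Fintype V] [DecidableEq V] {q : V → ℕ}

/-- `K O = W† O + O W + ∑ₖ Jₖ† O Jₖ` with `W + W† = - ∑ₖ Jₖ† Jₖ`. -/
lemma IsLiouvillianOn.exists_kraus {Y : Finset V} {K : SuperOp q} (hK : IsLiouvillianOn Y K) :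
    ∃ (W : Obs q) (n : ℕ) (J : Fin n → Obs q),
      W.conjTranspose + W + ∑ k, (J k).conjTranspose * J k = 0 ∧
      ∀ O, K O = W.conjTranspose * O + O * W + ∑ k, (J k).conjTranspose * O * J k := by
  obtain ⟨H, n, J, hH, -, -, h⟩ := hK
  set N := ∑ k, (J k).conjTranspose * J k with hN
  have hNh : N.conjTranspose = N := by
    simp [hN, Matrix.conjTranspose_sum, Matrix.conjTranspose_mul]
  have hW : (-(Complex.I • H) - (1 / 2 : ℂ) • N).conjTranspose =
      Complex.I • H - (1 / 2 : ℂ) • N := by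
    simp [Matrix.conjTranspose_sub, Matrix.conjTranspose_smul, hH.eq, hNh]
  refine ⟨-(Complex.I • H) - (1 / 2 : ℂ) • N, n, J, ?_, fun O => ?_⟩
  · rw [hW]; module
  · have : ∑ k, ((J k).conjTranspose * O * J k - (1 / 2 : ℂ) • ((J k).conjTranspose * J k * O +
        O * ((J k).conjTranspose * J k))) =
        ∑ k, (J k).conjTranspose * O * J k - (1 / 2 : ℂ) • (N * O + O * N) := by
      rw [Finset.sum_sub_distrib, ← Finset.smul_sum, Finset.sum_add_distrib, hN, Finset.sum_mul,
        Finset.mul_sum]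
    rw [h, this, hW]
    simp only [sub_mul, mul_sub, smul_mul_assoc, mul_smul_comm, mul_neg, smul_add, smul_sub]
    abel

/-- Up to the term `ε² W† O W`, the Euler step `1 + εK` is completely positive, with Kraus operators
`1 + εW` and `√ε J k`. Its value at `1` has no first-order part since `W† + W + ∑ J† J = 0`, so the
norm is `1 + O(ε²)`. -/
lemma IsLiouvillianOn.isDissipative {Y : Finset V} {K : SuperOp q} (hK : IsLiouvillianOn Y K) :
    IsDissipative K := by
  obtain ⟨W, n, J, hN, h⟩ := hK.exists_kraus
  have key : ∀ ε : ℝ, 0 ≤ ε → ‖1 + (ε : ℂ) • K‖ ≤ 1 + 2 * ‖W‖ ^ 2 * ε ^ 2 := by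
    intro ε hε
    refine ContinuousLinearMap.opNorm_le_bound _ (by positivity) fun O => ?_
    let T : Option (Fin n) → Obs q := fun k =>
      k.elim (1 + (ε : ℂ) • W) fun k => ((√ε : ℝ) : ℂ) • J k
    have hsq : ((√ε : ℝ) : ℂ) * ((√ε : ℝ) : ℂ) = ε := by
      rw [← Complex.ofReal_mul, Real.mul_self_sqrt hε]
    have hT : ∀ O : Obs q, ∑ k, (T k).conjTranspose * O * T k =
        O + (ε : ℂ) • (W.conjTranspose * O + O * W + ∑ k, (J k).conjTranspose * O * J k) +
          ((ε ^ 2 : ℝ) : ℂ) • (W.conjTranspose * O * W) := by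
      intro O
      rw [Fintype.sum_option]
      have h1 : ∀ k, (T (some k)).conjTranspose * O * T (some k) =
          (ε : ℂ) • ((J k).conjTranspose * O * J k) := by
        intro k
        simp only [T, Option.elim_some, Matrix.conjTranspose_smul, smul_mul_assoc, mul_smul_comm,
          smul_smul, Complex.star_def, Complex.conj_ofReal, hsq]
      have h2 : (T none).conjTranspose = 1 + (ε : ℂ) • W.conjTranspose := by
        simp [T, Matrix.conjTranspose_smul]
      have h3 : T none = 1 + (ε : ℂ) • W := rfl
      simp only [h1]
      rw [h2, h3, ← Finset.smul_sum]
      simp only [add_mul, mul_add, one_mul, mul_one, smul_mul_assoc, mul_smul_comm]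
      push_cast
      module
    have hone : ‖∑ k, (T k).conjTranspose * T k‖ ≤ 1 + ‖W‖ ^ 2 * ε ^ 2 := by
      have h1 := hT 1
      simp only [mul_one, one_mul] at h1
      rw [h1, hN, smul_zero, add_zero]
      refine (norm_add_le _ _).trans (add_le_add norm_one_matrix_le ?_)
      rw [norm_smul, Complex.norm_real, Real.norm_eq_abs, abs_of_nonneg (by positivity),
        Matrix.l2_opNorm_conjTranspose_mul_self]
      exact le_of_eq (by ring)
    have h4 : (1 + (ε : ℂ) • K) O = ∑ k, (T k).conjTranspose * O * T k -
        ((ε ^ 2 : ℝ) : ℂ) • (W.conjTranspose * O * W) := by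
      rw [hT O, ← h O]
      simp
    have h5 : ‖((ε ^ 2 : ℝ) : ℂ) • (W.conjTranspose * O * W)‖ ≤ ε ^ 2 * (‖W‖ * ‖O‖ * ‖W‖) := by
      rw [norm_smul, Complex.norm_real, Real.norm_eq_abs, abs_of_nonneg (by positivity)]
      gcongr
      refine (norm_mul_le _ _).trans ?_
      gcongr
      refine (norm_mul_le _ _).trans ?_
      rw [Matrix.l2_opNorm_conjTranspose]
    rw [h4]
    calc _ ≤ _ := norm_sub_le _ _
      _ ≤ (1 + ‖W‖ ^ 2 * ε ^ 2) * ‖O‖ + ε ^ 2 * (‖W‖ * ‖O‖ * ‖W‖) := by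
          refine add_le_add ((norm_sum_conjTranspose_mul_mul_le T O).trans ?_) h5
          gcongr
      _ = _ := by ring
  intro η hη
  have ht := tendsto_const_mul_nhdsGT_zero (c := 2 * ‖W‖ ^ 2 + 1) (by positivity)
  have h1 : ∀ᶠ x : ℝ in 𝓝[>] 0, x < η := mem_nhdsWithin_of_mem_nhds (Iio_mem_nhds hη)
  filter_upwards [ht.eventually h1, self_mem_nhdsWithin] with ε h2 h3
  have h3 : 0 < ε := h3
  refine (key ε h3.le).trans ?_
  nlinarith

end LiouvillianDissipative

/-! ### Compressions and single-site influences -/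

section Compression

variable {V : Type} [Fintype V] [DecidableEq V] {q : V → ℕ}

lemma embedObs_smul (X : Finset V) (c : ℂ)
    (a : Matrix ((i : X) → Fin (q i)) ((i : X) → Fin (q i)) ℂ) :
    embedObs q X (c • a) = c • embedObs q X a := by
  ext s s'
  simp only [embedObs, Matrix.smul_apply]
  split_ifs <;> simp

/-- The operator `|ω⟩⟨a|` on the sites of `S`. -/
noncomputable def ketBra (ω : BasisState q) (S : Finset V) (a : (i : S) → Fin (q i)) : Obs q :=
  embedObs q S (Matrix.single (fun i => ω i) a 1)

lemma supportedOn_ketBra (ω : BasisState q) (S : Finset V) (a : (i : S) → Fin (q i)) :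
    SupportedOn S (ketBra ω S a) := ⟨_, rfl⟩

lemma sum_ketBra_conjTranspose_mul (ω : BasisState q) (S : Finset V) :
    ∑ a, (ketBra ω S a).conjTranspose * ketBra ω S a = 1 := by
  simp only [ketBra, embedObs_conjTranspose, ← embedObs_mul, ← embedObs_sum]
  rw [← embedObs_one S]
  congr 1
  ext c d
  simp [Matrix.sum_apply, Matrix.single_apply, Matrix.one_apply, ite_and]

lemma ketBra_mul_embedObs (ω : BasisState q) (S : Finset V) (a : (i : S) → Fin (q i))
    (b : Matrix ((i : S) → Fin (q i)) ((i : S) → Fin (q i)) ℂ) :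
    ketBra ω S a * embedObs q S b = ∑ c, b a c • ketBra ω S c := by
  simp only [ketBra, ← embedObs_mul, ← embedObs_smul, ← embedObs_sum]
  congr 1
  ext u v
  by_cases hu : (fun i : S => ω i) = u
  · simp [Matrix.sum_apply, Matrix.single_apply, Matrix.mul_apply, hu]
  · simp [Matrix.sum_apply, Matrix.mul_apply, hu]

lemma embedObs_mul_ketBra_conjTranspose (ω : BasisState q) (S : Finset V)
    (a : (i : S) → Fin (q i)) (b : Matrix ((i : S) → Fin (q i)) ((i : S) → Fin (q i)) ℂ) :
    embedObs q S b * (ketBra ω S a).conjTranspose = ∑ c, b c a • (ketBra ω S c).conjTranspose := by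
  have := congrArg Matrix.conjTranspose (ketBra_mul_embedObs ω S a b.conjTranspose)
  rw [Matrix.conjTranspose_mul, embedObs_conjTranspose, Matrix.conjTranspose_conjTranspose] at this
  rw [this, Matrix.conjTranspose_sum]
  simp [Matrix.conjTranspose_smul]

/-- The unital completely positive map `O ↦ 𝟙_S ⊗ ⟨ω_S| O |ω_S⟩`, which projects onto the
observables acting trivially on `S`. -/
noncomputable def compress (ω : BasisState q) (S : Finset V) (O : Obs q) : Obs q :=
  ∑ a, (ketBra ω S a).conjTranspose * O * ketBra ω S a

/-- Since `|ω⟩⟨a| b = ∑_c b_{ac} |ω⟩⟨c|`, multiplying by `b` on the right or on the left produces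
the same double sum with `a` and `c` interchanged. -/
lemma trivialOn_compress (ω : BasisState q) (S : Finset V) (O : Obs q) :
    TrivialOn S (compress ω S O) := by
  rintro _ ⟨b, rfl⟩
  change compress ω S O * _ = _ * compress ω S O
  simp only [compress, Finset.sum_mul, Finset.mul_sum]
  have h1 : ∀ a, (ketBra ω S a).conjTranspose * O * ketBra ω S a * embedObs q S b =
      ∑ c, b a c • ((ketBra ω S a).conjTranspose * O * ketBra ω S c) := by
    intro a
    rw [mul_assoc, ketBra_mul_embedObs, Finset.mul_sum]
    simp only [mul_smul_comm]
  have h2 : ∀ a, embedObs q S b * ((ketBra ω S a).conjTranspose * O * ketBra ω S a) =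
      ∑ c, b c a • ((ketBra ω S c).conjTranspose * O * ketBra ω S a) := by
    intro a
    rw [← mul_assoc, ← mul_assoc, embedObs_mul_ketBra_conjTranspose, Finset.sum_mul,
      Finset.sum_mul]
    simp only [smul_mul_assoc]
  simp only [h1, h2]
  exact Finset.sum_comm

lemma TrivialOn.compress_eq {S : Finset V} {O : Obs q} (hO : TrivialOn S O) (ω : BasisState q) :
    compress ω S O = O := by
  have h : ∀ a, (ketBra ω S a).conjTranspose * O * ketBra ω S a =
      (ketBra ω S a).conjTranspose * ketBra ω S a * O := by
    intro a
    rw [mul_assoc, (hO _ (supportedOn_ketBra ω S a)).eq, mul_assoc]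
  simp only [compress, h]
  rw [← Finset.sum_mul, sum_ketBra_conjTranspose_mul, one_mul]

lemma norm_compress_le (ω : BasisState q) (S : Finset V) (O : Obs q) :
    ‖compress ω S O‖ ≤ ‖O‖ := by
  refine (norm_sum_conjTranspose_mul_mul_le _ _).trans ?_
  rw [sum_ketBra_conjTranspose_mul]
  exact (mul_le_mul_of_nonneg_right norm_one_matrix_le (norm_nonneg _)).trans (one_mul _).le

lemma compress_sub (ω : BasisState q) (S : Finset V) (O O' : Obs q) :
    compress ω S (O - O') = compress ω S O - compress ω S O' := by
  simp only [compress, mul_sub, sub_mul, Finset.sum_sub_distrib]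

lemma TrivialOn.compress {S T : Finset V} {O : Obs q} (hO : TrivialOn T O) (h : Disjoint S T)
    (ω : BasisState q) : TrivialOn T (compress ω S O) :=
  TrivialOn.sum _ fun a _ =>
    ((((supportedOn_ketBra ω S a).trivialOn h).conjTranspose).mul hO).mul
      ((supportedOn_ketBra ω S a).trivialOn h)

/-- The influence of site `i` on `O`: how far `O` is from acting trivially on `i`. -/
noncomputable def influence (ω : BasisState q) (i : V) (O : Obs q) : ℝ :=
  ‖O - compress ω {i} O‖

lemma influence_nonneg (ω : BasisState q) (i : V) (O : Obs q) : 0 ≤ influence ω i O :=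
  norm_nonneg _

lemma influence_eq_zero {i : V} {O : Obs q} (hO : TrivialOn {i} O) (ω : BasisState q) :
    influence ω i O = 0 := by
  rw [influence, hO.compress_eq, sub_self, norm_zero]

lemma influence_le (ω : BasisState q) (i : V) (O : Obs q) : influence ω i O ≤ 2 * ‖O‖ := by
  have := norm_sub_le O (compress ω {i} O)
  have := norm_compress_le ω {i} O
  rw [influence]
  linarith

lemma influence_le_add (ω : BasisState q) (i : V) (O O' : Obs q) :
    influence ω i O ≤ influence ω i O' + 2 * ‖O - O'‖ := by
  have h1 := influence_le ω i (O - O')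
  have h2 : O - compress ω {i} O = (O' - compress ω {i} O') +
      ((O - O') - compress ω {i} (O - O')) := by
    rw [compress_sub]; abel
  rw [influence, h2]
  exact (norm_add_le _ _).trans (add_le_add le_rfl h1)

/-- Matrix units on a union are products of matrix units on the parts. This lets a commutant be
checked one site at a time. -/
lemma embedObs_single_union {X Y : Finset V} (hXY : Disjoint X Y)
    (c d : (i : (X ∪ Y : Finset V)) → Fin (q i)) :
    embedObs q (X ∪ Y) (Matrix.single c d 1) =
      embedObs q X (Matrix.single (fun i => c ⟨i, Finset.mem_union_left _ i.2⟩)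
        (fun i => d ⟨i, Finset.mem_union_left _ i.2⟩) 1) *
      embedObs q Y (Matrix.single (fun i => c ⟨i, Finset.mem_union_right _ i.2⟩)
        (fun i => d ⟨i, Finset.mem_union_right _ i.2⟩) 1) := by
  have split : ∀ (c : (i : (X ∪ Y : Finset V)) → Fin (q i)) (s : BasisState q),
      (c = fun i : (X ∪ Y : Finset V) => s i) ↔
        ((fun i : X => c ⟨i, Finset.mem_union_left _ i.2⟩) = fun i : X => s i) ∧
        ((fun i : Y => c ⟨i, Finset.mem_union_right _ i.2⟩) = fun i : Y => s i) := by
    intro c s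
    constructor
    · rintro rfl; exact ⟨rfl, rfl⟩
    · rintro ⟨h1, h2⟩
      funext ⟨i, hi⟩
      rcases Finset.mem_union.mp hi with h | h
      · exact congrFun h1 ⟨i, h⟩
      · exact congrFun h2 ⟨i, h⟩
  ext s s'
  rw [embedObs_mul_embedObs_apply hXY]
  simp only [embedObs, Finset.mem_union, not_or, and_imp, Matrix.single_apply, split]
  congr 1
  rw [mul_ite, mul_one, mul_zero, ← ite_and]
  exact if_congr (by tauto) rfl rfl

lemma TrivialOn.union {X Y : Finset V} (hXY : Disjoint X Y) {O : Obs q} (hX : TrivialOn X O)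
    (hY : TrivialOn Y O) : TrivialOn (X ∪ Y) O := by
  rintro _ ⟨b, rfl⟩
  rw [Matrix.matrix_eq_sum_single b]
  simp only [embedObs_sum]
  refine Commute.sum_right _ _ _ fun c _ => Commute.sum_right _ _ _ fun d _ => ?_
  have : Matrix.single c d (b c d) = b c d • Matrix.single c d 1 := by simp
  rw [this, embedObs_smul, embedObs_single_union hXY]
  exact ((hX _ ⟨_, rfl⟩).mul_right (hY _ ⟨_, rfl⟩)).smul_right _

/-- An observable is, up to the sum of the influences of the sites of `S`, close to one that acts
trivially on `S`. -/
lemma exists_trivialOn_norm_sub_le (ω : BasisState q) (S : Finset V) (O : Obs q) :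
    ∃ B : Obs q, TrivialOn S B ∧ ‖B‖ ≤ ‖O‖ ∧ ‖O - B‖ ≤ ∑ i ∈ S, influence ω i O := by
  induction S using Finset.induction_on with
  | empty =>
    refine ⟨O, ?_, le_rfl, by simp⟩
    rintro _ ⟨b, rfl⟩
    -- The empty region has a single configuration, so its operators are scalars.
    have : b = b default default • (1 : Matrix _ _ ℂ) := by
      ext c d
      rw [Subsingleton.elim c default, Subsingleton.elim d default]
      simp
    rw [this, embedObs_smul, embedObs_one]
    exact (Commute.one_right O).smul_right _
  | insert i S hi ih =>
    obtain ⟨B, hB, hBn, hO⟩ := ih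
    have hd : Disjoint {i} S := Finset.disjoint_singleton_left.mpr hi
    refine ⟨compress ω {i} B, ?_, (norm_compress_le _ _ _).trans hBn, ?_⟩
    · exact (trivialOn_compress ω {i} B).union hd (hB.compress hd ω)
    · rw [Finset.sum_insert hi]
      -- Each new site costs the influence on the original `O`, not on the partially compressed `B`,
      -- because compression does not increase the earlier error.
      have : O - compress ω {i} B = (O - compress ω {i} O) + compress ω {i} (O - B) := by
        rw [compress_sub]; abel
      rw [this]
      exact (norm_add_le _ _).trans
        (add_le_add le_rfl ((norm_compress_le _ _ _).trans hO))

lemma IsLiouvillianOn.norm_apply_le {Z : Finset V} {K : SuperOp q} (hK : IsLiouvillianOn Z K)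
    (ω : BasisState q) (O : Obs q) : ‖K O‖ ≤ ‖K‖ * ∑ i ∈ Z, influence ω i O := by
  obtain ⟨B, hB, -, hO⟩ := exists_trivialOn_norm_sub_le ω Z O
  have : K O = K (O - B) := by rw [map_sub, hK.apply_eq_zero hB, sub_zero]
  rw [this]
  exact (K.le_opNorm _).trans (by gcongr)

end Compression

/-! ### Lieb-Robinson bounds for a reproducing kernel -/

section Dynamics

variable {V : Type} [Fintype V] [DecidableEq V] {q : V → ℕ}

/-- `F` is a reproducing kernel of the interaction graph: it dominates the two-site couplings, it
has row sums at most `σ`, and `F * F ≤ p F`. -/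
structure IsReproducing (L : Finset V → SuperOp q) (F : V → V → ℝ) (σ p : ℝ) : Prop where
  pos : ∀ i j, 0 < F i j
  diag : ∀ i, F i i = 1
  coupling : ∀ i j, i ≠ j → ∑ Z : Finset V with i ∈ Z ∧ j ∈ Z, ‖L Z‖ ≤ F i j
  row : ∀ i, ∑ j, F i j ≤ σ
  conv : ∀ i j, ∑ k, F i k * F k j ≤ p * F i j

variable {L : Finset V → SuperOp q} {F : V → V → ℝ} {σ p : ℝ}

lemma IsReproducing.one_le (hF : IsReproducing L F σ p) (i : V) : 1 ≤ σ := by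
  refine le_trans ?_ (hF.row i)
  rw [← hF.diag i]
  exact Finset.single_le_sum (f := fun j => F i j) (fun j _ => (hF.pos i j).le)
    (Finset.mem_univ i)

/-- The terms acting on `i` and on some other site. -/
lemma norm_sum_coupling_apply_le (hF : IsReproducing L F σ p) (hL : ∀ Z, IsLiouvillianOn Z (L Z))
    (ω : BasisState q) (i : V) (O : Obs q) :
    ‖(∑ Z : Finset V with i ∈ Z ∧ Z ≠ {i}, L Z) O‖ ≤ σ * ∑ k, F i k * influence ω k O := by
  have hσ := hF.one_le i
  -- Off the diagonal this is the coupling bound, as `σ ≥ 1`. For `k = i` every such `Z` contains a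
  -- further site `j`, and summing the couplings over `j` gives at most `σ = σ * F i i`.
  have hΓ : ∀ k, ∑ Z : Finset V with (i ∈ Z ∧ Z ≠ {i}) ∧ k ∈ Z, ‖L Z‖ ≤ σ * F i k := by
    intro k
    by_cases hk : i = k
    · subst hk
      rw [hF.diag, mul_one]
      calc _ ≤ ∑ Z : Finset V with (i ∈ Z ∧ Z ≠ {i}) ∧ i ∈ Z,
            ∑ j ∈ Finset.univ.erase i, if j ∈ Z then ‖L Z‖ else 0 := by
            refine Finset.sum_le_sum fun Z hZ => ?_
            rw [Finset.mem_filter] at hZ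
            obtain ⟨j, hj, hji⟩ : ∃ j ∈ Z, j ≠ i := by
              by_contra! h
              exact hZ.2.1.2 (Finset.eq_singleton_iff_unique_mem.mpr ⟨hZ.2.2, h⟩)
            refine le_trans ?_ (Finset.single_le_sum (fun j _ => ?_)
              (Finset.mem_erase.mpr ⟨hji, Finset.mem_univ j⟩))
            · rw [if_pos hj]
            · split_ifs
              exacts [norm_nonneg _, le_rfl]
        _ = ∑ j ∈ Finset.univ.erase i, ∑ Z : Finset V with (i ∈ Z ∧ Z ≠ {i}) ∧ i ∈ Z,
            if j ∈ Z then ‖L Z‖ else 0 := Finset.sum_comm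
        _ ≤ ∑ j ∈ Finset.univ.erase i, F i j := by
            refine Finset.sum_le_sum fun j hj => le_trans ?_
              (hF.coupling i j (Finset.ne_of_mem_erase hj).symm)
            rw [← Finset.sum_filter, Finset.filter_filter]
            refine Finset.sum_le_sum_of_subset_of_nonneg (fun Z hZ => ?_)
              fun Z _ _ => norm_nonneg _
            simp only [Finset.mem_filter] at hZ ⊢
            tauto
        _ ≤ ∑ j, F i j := Finset.sum_le_sum_of_subset_of_nonneg (Finset.erase_subset _ _)
            fun j _ _ => (hF.pos i j).le
        _ ≤ σ := hF.row i
    · refine le_trans ?_ ((hF.coupling i k hk).trans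
        (le_mul_of_one_le_left (hF.pos i k).le hσ))
      refine Finset.sum_le_sum_of_subset_of_nonneg (fun Z hZ => ?_) fun Z _ _ => norm_nonneg _
      simp only [Finset.mem_filter] at hZ ⊢
      tauto
  calc _ = ‖∑ Z : Finset V with i ∈ Z ∧ Z ≠ {i}, L Z O‖ := by rw [sum_apply]
    _ ≤ ∑ Z : Finset V with i ∈ Z ∧ Z ≠ {i}, ‖L Z‖ * ∑ k ∈ Z, influence ω k O :=
        norm_sum_le_of_le _ fun Z _ => (hL Z).norm_apply_le ω O
    _ = ∑ Z : Finset V with i ∈ Z ∧ Z ≠ {i}, ∑ k,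
          if k ∈ Z then ‖L Z‖ * influence ω k O else 0 := by
        refine Finset.sum_congr rfl fun Z _ => ?_
        rw [Finset.mul_sum, ← Finset.sum_filter]
        simp
    _ = ∑ k, (∑ Z : Finset V with (i ∈ Z ∧ Z ≠ {i}) ∧ k ∈ Z, ‖L Z‖) * influence ω k O := by
        rw [Finset.sum_comm]
        refine Finset.sum_congr rfl fun k _ => ?_
        rw [← Finset.sum_filter, Finset.filter_filter, Finset.sum_mul]
    _ ≤ ∑ k, σ * F i k * influence ω k O := by
        gcongr with k
        · exact influence_nonneg ω k O
        · exact hΓ k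
    _ = _ := by rw [Finset.mul_sum]; simp only [mul_assoc]

/-- The observables acting trivially on `S`. -/
def trivialSubmodule (q : V → ℕ) (S : Finset V) : Submodule ℂ (Obs q) where
  carrier := {O | TrivialOn S O}
  add_mem' := TrivialOn.add
  zero_mem' := fun b _ => Commute.zero_left b
  smul_mem' := fun c _ h => TrivialOn.smul c h

/-- The remaining terms either miss `i`, and preserve triviality there, or act on `i` alone, and
annihilate observables trivial there. So the evolved compression of `A` stays trivial on `i`, and
the evolution is a contraction. The factor 2 is the Lipschitz constant of the influence. -/
lemma influence_exp_decoupled_le (hL : ∀ Z, IsLiouvillianOn Z (L Z)) (ω : BasisState q) (i : V)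
    (A : Obs q) {s : ℝ} (hs : 0 ≤ s) :
    influence ω i (NormedSpace.exp ((s : ℂ) • ∑ Z : Finset V with ¬ (i ∈ Z ∧ Z ≠ {i}), L Z) A) ≤
      2 * influence ω i A := by
  set G := ∑ Z : Finset V with ¬ (i ∈ Z ∧ Z ≠ {i}), L Z with hG
  have hGd : IsDissipative G := isDissipative_sum _ fun Z _ => (hL Z).isDissipative
  have hGp : ∀ O ∈ trivialSubmodule q {i}, G O ∈ trivialSubmodule q {i} := by
    intro O hO
    rw [hG, sum_apply]
    refine Submodule.sum_mem _ fun Z hZ => ?_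
    rw [Finset.mem_filter, not_and_not_right] at hZ
    by_cases hi : i ∈ Z
    · obtain rfl := hZ.2 hi
      rw [(hL {i}).apply_eq_zero hO]
      exact Submodule.zero_mem _
    · exact (hL Z).trivialOn (Finset.disjoint_singleton_right.mpr hi) hO
  have h1 : TrivialOn {i} (NormedSpace.exp ((s : ℂ) • G) (compress ω {i} A)) :=
    exp_apply_mem (p := trivialSubmodule q {i}) (isClosed_trivialOn {i}) hGp _
      (trivialOn_compress ω {i} A)
  have h2 := influence_le_add ω i (NormedSpace.exp ((s : ℂ) • G) A)
    (NormedSpace.exp ((s : ℂ) • G) (compress ω {i} A))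
  rw [influence_eq_zero h1, zero_add, ← map_sub] at h2
  refine h2.trans ?_
  gcongr
  refine (ContinuousLinearMap.le_opNorm _ _).trans ?_
  exact mul_le_of_le_one_left (norm_nonneg _) (hGd.norm_exp_le hs)

lemma norm_heisenbergEvolution_le (hL : ∀ Z, IsLiouvillianOn Z (L Z)) {s : ℝ} (hs : 0 ≤ s) :
    ‖heisenbergEvolution L s‖ ≤ 1 :=
  IsDissipative.norm_exp_le (isDissipative_sum _ fun Z _ => (hL Z).isDissipative) hs

lemma norm_heisenbergEvolution_apply_le (hL : ∀ Z, IsLiouvillianOn Z (L Z)) {s : ℝ} (hs : 0 ≤ s)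
    (A : Obs q) : ‖heisenbergEvolution L s A‖ ≤ ‖A‖ :=
  (ContinuousLinearMap.le_opNorm _ _).trans
    (mul_le_of_le_one_left (norm_nonneg _) (norm_heisenbergEvolution_le hL hs))

/-- One step of a bootstrap: a bound on all influences with constant `M` is fed into Duhamel's
formula against the evolution decoupled at `i`. The inequality `F * F ≤ p F` returns the same
spatial profile with a new constant. -/
lemma influence_heisenbergEvolution_le_of_le (hF : IsReproducing L F σ p)
    (hL : ∀ Z, IsLiouvillianOn Z (L Z)) (ω : BasisState q) {S : Finset V} {A : Obs q}
    (hA : TrivialOn Sᶜ A) {τ M : ℝ} (hM0 : 0 ≤ M)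
    (hM : ∀ s ∈ Set.Icc 0 τ, ∀ k,
      influence ω k (heisenbergEvolution L s A) ≤ M * ∑ l ∈ S, F k l)
    {s : ℝ} (hs : s ∈ Set.Icc 0 τ) (i : V) :
    influence ω i (heisenbergEvolution L s A) ≤
      (4 * ‖A‖ + 2 * (σ * p * M * τ)) * ∑ l ∈ S, F i l := by
  set G := ∑ Z : Finset V with ¬ (i ∈ Z ∧ Z ≠ {i}), L Z with hG
  have hGd : IsDissipative G := isDissipative_sum _ fun Z _ => (hL Z).isDissipative
  have hσ := hF.one_le i
  have hp : 0 ≤ p := by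
    have := hF.conv i i
    rw [hF.diag, mul_one] at this
    exact (Finset.sum_nonneg fun k _ => (mul_pos (hF.pos i k) (hF.pos k i)).le).trans this
  have hg : 0 ≤ ∑ l ∈ S, F i l := Finset.sum_nonneg fun l _ => (hF.pos i l).le
  have hsplit : ∑ Z, L Z - G = ∑ Z : Finset V with i ∈ Z ∧ Z ≠ {i}, L Z := by
    rw [hG, ← Finset.sum_filter_add_sum_filter_not Finset.univ
      (fun Z : Finset V => i ∈ Z ∧ Z ≠ {i}), add_sub_cancel_right]
  have h1 := norm_exp_apply_sub_exp_apply_le (L := ∑ Z, L Z) hGd A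
    (c := σ * p * M * ∑ l ∈ S, F i l) hs.1 (fun u hu => by
      rw [hsplit]
      refine (norm_sum_coupling_apply_le hF hL ω i _).trans ?_
      have h2 : ∑ k, F i k * influence ω k (heisenbergEvolution L u A) ≤
          p * M * ∑ l ∈ S, F i l := by
        calc _ ≤ ∑ k, F i k * (M * ∑ l ∈ S, F k l) := by
              gcongr with k
              · exact (hF.pos i k).le
              · exact hM u ⟨hu.1, hu.2.trans hs.2⟩ k
          _ = M * ∑ l ∈ S, ∑ k, F i k * F k l := by
              rw [Finset.sum_comm, Finset.mul_sum]
              refine Finset.sum_congr rfl fun k _ => ?_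
              rw [Finset.mul_sum, Finset.mul_sum, Finset.mul_sum]
              exact Finset.sum_congr rfl fun l _ => by ring
          _ ≤ M * ∑ l ∈ S, p * F i l := by
              gcongr with l
              exact hF.conv i l
          _ = _ := by rw [← Finset.mul_sum]; ring
      calc _ ≤ σ * (p * M * ∑ l ∈ S, F i l) := by
            refine mul_le_mul_of_nonneg_left h2 (zero_le_one.trans hσ)
        _ = _ := by ring)
  have h3 := influence_le_add ω i (heisenbergEvolution L s A) (NormedSpace.exp ((s : ℂ) • G) A)
  have h4 := influence_exp_decoupled_le hL ω i A hs.1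
  -- On `S` the profile is at least `F i i = 1`; off `S` the initial influence vanishes.
  have h5 : influence ω i A ≤ 2 * ‖A‖ * ∑ l ∈ S, F i l := by
    by_cases hi : i ∈ S
    · refine (influence_le ω i A).trans (le_mul_of_one_le_right (by positivity) ?_)
      rw [← hF.diag i]
      exact Finset.single_le_sum (f := fun j => F i j) (fun j _ => (hF.pos i j).le) hi
    · rw [influence_eq_zero (hA.anti (by simpa using hi))]
      positivity
  have h6 : σ * p * M * (∑ l ∈ S, F i l) * s ≤ σ * p * M * (∑ l ∈ S, F i l) * τ :=
    mul_le_mul_of_nonneg_left hs.2 (by positivity)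
  change ‖heisenbergEvolution L s A - _‖ ≤ _ at h1
  rw [← hG] at h4
  nlinarith

/-- The Lieb-Robinson bound for short times. -/
lemma influence_heisenbergEvolution_le (hF : IsReproducing L F σ p)
    (hL : ∀ Z, IsLiouvillianOn Z (L Z)) (ω : BasisState q) {S : Finset V} (hS : S.Nonempty)
    {A : Obs q} (hA : TrivialOn Sᶜ A) {τ : ℝ} (hτ : 0 ≤ τ) (hτ' : 4 * (σ * p * τ) ≤ 1) (i : V) :
    influence ω i (heisenbergEvolution L τ A) ≤ 8 * ‖A‖ * ∑ l ∈ S, F i l := by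
  have hg : ∀ i, 0 < ∑ l ∈ S, F i l := fun i => Finset.sum_pos (fun l _ => hF.pos i l) hS
  -- `sSup D` is the best constant `M` on `[0, τ]`. It is finite a priori because there are finitely
  -- many sites and influences are at most `2 ‖A‖`.
  set D : Set ℝ := {x | ∃ k, ∃ s ∈ Set.Icc 0 τ,
    x = influence ω k (heisenbergEvolution L s A) / ∑ l ∈ S, F k l} with hD
  have hbdd : BddAbove D := by
    refine ⟨∑ k, 2 * ‖A‖ / ∑ l ∈ S, F k l, ?_⟩
    rintro _ ⟨k, s, hs, rfl⟩
    refine le_trans ?_ (Finset.single_le_sum (f := fun k => 2 * ‖A‖ / ∑ l ∈ S, F k l)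
      (fun k _ => div_nonneg (by positivity) (hg k).le) (Finset.mem_univ k))
    have := (influence_le ω k (heisenbergEvolution L s A)).trans
      (mul_le_mul_of_nonneg_left (norm_heisenbergEvolution_apply_le hL hs.1 A) zero_le_two)
    exact div_le_div_of_nonneg_right this (hg k).le
  have hmem : ∀ k, ∀ s ∈ Set.Icc 0 τ,
      influence ω k (heisenbergEvolution L s A) / (∑ l ∈ S, F k l) ≤ sSup D :=
    fun k s hs => le_csSup hbdd ⟨k, s, hs, rfl⟩
  have hM0 : 0 ≤ sSup D := (div_nonneg (influence_nonneg _ _ _) (hg i).le).trans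
    (hmem i τ ⟨hτ, le_rfl⟩)
  have hle : sSup D ≤ 4 * ‖A‖ + 2 * (σ * p * sSup D * τ) := by
    refine csSup_le ⟨_, i, τ, ⟨hτ, le_rfl⟩, rfl⟩ ?_
    rintro _ ⟨k, s, hs, rfl⟩
    rw [div_le_iff₀ (hg k)]
    exact influence_heisenbergEvolution_le_of_le hF hL ω hA hM0
      (fun s hs k => (div_le_iff₀ (hg k)).mp (hmem k s hs)) hs k
  -- The choice of `τ` makes the bootstrap read `M ≤ 4 ‖A‖ + M / 2`.
  have h8 : sSup D ≤ 8 * ‖A‖ := by nlinarith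
  exact (div_le_iff₀ (hg i)).mp ((hmem i τ ⟨hτ, le_rfl⟩).trans h8)

/-- Approximation of the evolution through `n` time slices by observables supported on an
increasing sequence of regions. -/
lemma exists_trivialOn_norm_pow_sub_le (hF : IsReproducing L F σ p)
    (hL : ∀ Z, IsLiouvillianOn Z (L Z)) (ω : BasisState q) {S : ℕ → Finset V}
    (hS : ∀ k, (S k).Nonempty) {A : Obs q} (hA : TrivialOn (S 0)ᶜ A) {τ : ℝ} (hτ : 0 ≤ τ)
    (hτ' : 4 * (σ * p * τ) ≤ 1) (n : ℕ) :
    ∃ B : Obs q, TrivialOn (S n)ᶜ B ∧ ‖B‖ ≤ ‖A‖ ∧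
      ‖((heisenbergEvolution L τ) ^ n) A - B‖ ≤
        8 * ‖A‖ * ∑ k ∈ Finset.range n, ∑ j ∈ (S (k + 1))ᶜ, ∑ l ∈ S k, F j l := by
  induction n with
  | zero => exact ⟨A, hA, le_rfl, by simp⟩
  | succ n ih =>
    obtain ⟨B, hB, hBA, hAB⟩ := ih
    obtain ⟨B', hB', hBB, h⟩ :=
      exists_trivialOn_norm_sub_le ω (S (n + 1))ᶜ (heisenbergEvolution L τ B)
    refine ⟨B', hB', hBB.trans ((norm_heisenbergEvolution_apply_le hL hτ B).trans hBA), ?_⟩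
    -- The old error is carried along by a contraction; the new one comes from compressing the
    -- evolved approximant `B`, to which the short-time bound on `S n` applies afresh.
    have h1 : ((heisenbergEvolution L τ) ^ (n + 1)) A - B' =
        heisenbergEvolution L τ (((heisenbergEvolution L τ) ^ n) A - B) +
          (heisenbergEvolution L τ B - B') := by
      rw [pow_succ', map_sub]
      change heisenbergEvolution L τ (((heisenbergEvolution L τ) ^ n) A) - B' = _
      abel
    rw [h1, Finset.sum_range_succ, mul_add]
    refine (norm_add_le _ _).trans (add_le_add
      ((norm_heisenbergEvolution_apply_le hL hτ _).trans hAB) (h.trans ?_))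
    rw [Finset.mul_sum]
    refine Finset.sum_le_sum fun j _ => ?_
    refine (influence_heisenbergEvolution_le hF hL ω (hS n) hB hτ hτ' j).trans ?_
    gcongr
    exact Finset.sum_nonneg fun l _ => (hF.pos j l).le

lemma heisenbergEvolution_nat_mul (L : Finset V → SuperOp q) (n : ℕ) (τ : ℝ) :
    heisenbergEvolution L (n * τ) = (heisenbergEvolution L τ) ^ n :=
  exp_nat_mul_smul _ n τ

end Dynamics

/-! ### Lattice sums and the power-law kernel -/

section Lattice

variable {d : ℕ}

lemma siteDist_eq_dist (x y : Fin d → ℤ) :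
    siteDist x y = dist (WithLp.toLp 2 fun k => (x k : ℝ)) (WithLp.toLp 2 fun k => (y k : ℝ)) := by
  simp [EuclideanSpace.dist_eq, siteDist, Real.dist_eq, sq_abs]

lemma siteDist_comm (x y : Fin d → ℤ) : siteDist x y = siteDist y x := by
  simp only [siteDist_eq_dist, dist_comm]

lemma siteDist_triangle (x y z : Fin d → ℤ) : siteDist x z ≤ siteDist x y + siteDist y z := by
  simp only [siteDist_eq_dist]
  exact dist_triangle _ _ _

lemma siteDist_nonneg (x y : Fin d → ℤ) : 0 ≤ siteDist x y := Real.sqrt_nonneg _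

lemma siteDist_self (x : Fin d → ℤ) : siteDist x x = 0 := by
  rw [siteDist_eq_dist, dist_self]

lemma abs_coord_sub_le_siteDist (x y : Fin d → ℤ) (k : Fin d) :
    |(x k : ℝ) - y k| ≤ siteDist x y := by
  rw [← Real.sqrt_sq_eq_abs]
  exact Real.sqrt_le_sqrt (Finset.single_le_sum (f := fun k => ((x k : ℝ) - y k) ^ 2)
    (fun k _ => sq_nonneg _) (Finset.mem_univ k))

lemma one_le_siteDist {x y : Fin d → ℤ} (h : x ≠ y) : 1 ≤ siteDist x y := by
  obtain ⟨k, hk⟩ := Function.ne_iff.mp h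
  refine le_trans ?_ (abs_coord_sub_le_siteDist x y k)
  exact_mod_cast Int.one_le_abs (sub_ne_zero.mpr hk)

/-- Removing the centre makes the bound valid for `R < 1` as well, where the set is empty. For `R ≥
1` the ball lies in a cube with `2⌊R⌋ + 1 ≤ 3R` sites per side. -/
lemma card_punctured_ball_le (x : Fin d → ℤ) (T : Finset (Fin d → ℤ)) {R : ℝ} (hR : 0 < R) :
    ((T.filter fun y => x ≠ y ∧ siteDist x y ≤ R).card : ℝ) ≤ (3 * R) ^ d := by
  rcases (T.filter fun y => x ≠ y ∧ siteDist x y ≤ R).eq_empty_or_nonempty with h | ⟨y, hy⟩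
  · rw [h]; simp; positivity
  have hR1 : 1 ≤ R := (one_le_siteDist (Finset.mem_filter.mp hy).2.1).trans
    (Finset.mem_filter.mp hy).2.2
  have hsub : (T.filter fun y => x ≠ y ∧ siteDist x y ≤ R) ⊆
      Fintype.piFinset fun k => Finset.Icc (x k - (⌊R⌋₊ : ℤ)) (x k + (⌊R⌋₊ : ℤ)) := by
    intro y hy
    rw [Fintype.mem_piFinset]
    intro k
    have h1 := (abs_coord_sub_le_siteDist x y k).trans (Finset.mem_filter.mp hy).2.2
    have h2 : |x k - y k| ≤ (⌊R⌋₊ : ℤ) := by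
      rw [Int.abs_eq_natAbs]
      norm_cast
      refine Nat.le_floor ?_
      rw [Nat.cast_natAbs]
      exact_mod_cast h1
    rw [abs_le] at h2
    rw [Finset.mem_Icc]
    omega
  have hcard := Finset.card_le_card hsub
  rw [Fintype.card_piFinset] at hcard
  have h3 : ∀ k : Fin d, (Finset.Icc (x k - (⌊R⌋₊ : ℤ)) (x k + (⌊R⌋₊ : ℤ))).card =
      2 * ⌊R⌋₊ + 1 := by
    intro k
    rw [Int.card_Icc]
    omega
  simp only [h3, Finset.prod_const, Finset.card_univ, Fintype.card_fin] at hcard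
  calc _ ≤ (((2 * ⌊R⌋₊ + 1) ^ d : ℕ) : ℝ) := by exact_mod_cast hcard
    _ = (2 * (⌊R⌋₊ : ℝ) + 1) ^ d := by push_cast; rfl
    _ ≤ (3 * R) ^ d := by
        gcongr
        have := Nat.floor_le hR.le
        linarith

/-- The tails of `∑ y, dist(x, y)^(-β)` for `β > d`. -/
lemma exists_tail_sum_le (d : ℕ) {β : ℝ} (hβ : (d : ℝ) < β) :
    ∃ C : ℝ, 0 < C ∧ ∀ (x : Fin d → ℤ) (T : Finset (Fin d → ℤ)) (l : ℝ), 0 < l →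
      ∑ y ∈ T with l < siteDist x y, siteDist x y ^ (-β) ≤ C * l ^ ((d : ℝ) - β) := by
  have hβ0 : 0 < β := (Nat.cast_nonneg d).trans_lt hβ
  -- The sum is split into dyadic shells of radius `2^k l`, which form a geometric series of ratio
  -- `a < 1`. The constant `6^d` counts the sites within the outer radius `2^(k+1) l`.
  set a : ℝ := 2 ^ ((d : ℝ) - β) with ha
  have ha0 : 0 < a := by positivity
  have ha1 : a < 1 := Real.rpow_lt_one_of_one_lt_of_neg one_lt_two (by linarith)
  refine ⟨6 ^ d * (1 - a)⁻¹, mul_pos (by positivity) (inv_pos.mpr (by linarith)),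
    fun x T l hl => ?_⟩
  have hk : ∀ y : Fin d → ℤ, ∃ k : ℕ, l < siteDist x y →
      2 ^ k * l ≤ siteDist x y ∧ siteDist x y ≤ 2 ^ (k + 1) * l := by
    intro y
    by_cases h : l < siteDist x y
    · obtain ⟨k, h1, h2⟩ := exists_nat_pow_near ((one_le_div hl).mpr h.le) (one_lt_two (α := ℝ))
      exact ⟨k, fun _ => ⟨(le_div_iff₀ hl).mp h1, ((div_lt_iff₀ hl).mp h2).le⟩⟩
    · exact ⟨0, fun h' => absurd h' h⟩
  choose κ hκ using hk
  set U := T.filter fun y => l < siteDist x y with hU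
  have hfib : ∀ k ∈ U.image κ, ∑ y ∈ U with κ y = k, siteDist x y ^ (-β) ≤
      6 ^ d * l ^ ((d : ℝ) - β) * a ^ k := by
    intro k _
    have hpos : (0 : ℝ) < 2 ^ k * l := by positivity
    calc _ ≤ ∑ y ∈ U with κ y = k, (2 ^ k * l) ^ (-β) := by
          refine Finset.sum_le_sum fun y hy => ?_
          rw [Finset.mem_filter, hU, Finset.mem_filter] at hy
          refine Real.rpow_le_rpow_of_nonpos hpos ?_ (by linarith)
          rw [← hy.2]
          exact (hκ y hy.1.2).1
      _ = ((U.filter fun y => κ y = k).card : ℝ) * (2 ^ k * l) ^ (-β) := by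
          rw [Finset.sum_const, nsmul_eq_mul]
      _ ≤ (3 * (2 ^ (k + 1) * l)) ^ d * (2 ^ k * l) ^ (-β) := by
          gcongr
          refine le_trans ?_ (card_punctured_ball_le x T (by positivity))
          refine Nat.cast_le.mpr (Finset.card_le_card fun y hy => by
          rw [Finset.mem_filter, hU, Finset.mem_filter] at hy
          rw [Finset.mem_filter]
          refine ⟨hy.1.1, ?_, hy.2 ▸ (hκ y hy.1.2).2⟩
          rintro rfl
          rw [siteDist_self] at hy
          exact absurd hy.1.2 hl.not_gt)
      _ = 6 ^ d * (2 ^ k * l) ^ ((d : ℝ) - β) := by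
          have h6 : 3 * (2 ^ (k + 1) * l) = 6 * (2 ^ k * l) := by ring
          rw [sub_eq_add_neg, Real.rpow_add hpos, Real.rpow_natCast, h6, mul_pow, mul_assoc]
      _ = _ := by
          rw [Real.mul_rpow (by positivity) hl.le, ha, ← Real.rpow_natCast 2 k,
            ← Real.rpow_natCast _ k, ← Real.rpow_mul two_pos.le, ← Real.rpow_mul two_pos.le,
            mul_comm (k : ℝ)]
          ring
  calc ∑ y ∈ U, siteDist x y ^ (-β) = ∑ k ∈ U.image κ, ∑ y ∈ U with κ y = k,
        siteDist x y ^ (-β) :=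
        (Finset.sum_fiberwise_of_maps_to (fun y hy => Finset.mem_image_of_mem κ hy) _).symm
    _ ≤ ∑ k ∈ U.image κ, 6 ^ d * l ^ ((d : ℝ) - β) * a ^ k := Finset.sum_le_sum hfib
    _ = 6 ^ d * l ^ ((d : ℝ) - β) * ∑ k ∈ U.image κ, a ^ k := by rw [Finset.mul_sum]
    _ ≤ 6 ^ d * l ^ ((d : ℝ) - β) * (1 - a)⁻¹ := by
        gcongr
        rw [← tsum_geometric_of_lt_one ha0.le ha1]
        exact (summable_geometric_of_lt_one ha0.le ha1).sum_le_tsum _ fun k _ => by positivity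
    _ = _ := by ring

/-- The power-law kernel, regularized on the diagonal. -/
noncomputable def powerKernel (α : ℝ) (x y : Fin d → ℤ) : ℝ := max 1 (siteDist x y) ^ (-α)

lemma powerKernel_pos (α : ℝ) (x y : Fin d → ℤ) : 0 < powerKernel α x y :=
  Real.rpow_pos_of_pos (zero_lt_one.trans_le (le_max_left _ _)) _

lemma powerKernel_comm (α : ℝ) (x y : Fin d → ℤ) : powerKernel α x y = powerKernel α y x := by
  rw [powerKernel, siteDist_comm, powerKernel]

lemma powerKernel_of_ne (α : ℝ) {x y : Fin d → ℤ} (h : x ≠ y) :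
    powerKernel α x y = siteDist x y ^ (-α) := by
  rw [powerKernel, max_eq_right (one_le_siteDist h)]

lemma powerKernel_self (α : ℝ) (x : Fin d → ℤ) : powerKernel α x x = 1 := by
  rw [powerKernel, siteDist_self, max_eq_left zero_le_one, Real.one_rpow]

/-- By the triangle inequality one of the two regularized distances is at least half that from `x`
to `z`. Its factor is at most `2^α` times the kernel at `(x, z)`, and the other factor is kept. -/
lemma powerKernel_mul_le {α : ℝ} (hα : 0 ≤ α) (x y z : Fin d → ℤ) :
    powerKernel α x y * powerKernel α y z ≤
      2 ^ α * powerKernel α x z * (powerKernel α x y + powerKernel α y z) := by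
  have key : ∀ s t : ℝ, 1 ≤ s → 1 ≤ t → t ≤ 2 * s → s ^ (-α) ≤ 2 ^ α * t ^ (-α) := by
    intro s t hs ht h
    have : (2 : ℝ) ^ α = (1 / 2) ^ (-α) := by
      rw [one_div, Real.inv_rpow two_pos.le, Real.rpow_neg two_pos.le, inv_inv]
    rw [this, ← Real.mul_rpow (by norm_num) (by linarith)]
    exact Real.rpow_le_rpow_of_nonpos (by linarith) (by linarith) (by linarith)
  have h1 := powerKernel_pos α x y
  have h2 := powerKernel_pos α y z
  have h3 := powerKernel_pos α x z
  have hc : (0 : ℝ) < 2 ^ α * powerKernel α x z := by positivity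
  have htri : max 1 (siteDist x z) ≤ max 1 (siteDist x y) + max 1 (siteDist y z) := by
    refine max_le ?_ ((siteDist_triangle x y z).trans
      (add_le_add (le_max_right _ _) (le_max_right _ _)))
    linarith [le_max_left 1 (siteDist x y), le_max_left 1 (siteDist y z)]
  rcases le_total (max 1 (siteDist x y)) (max 1 (siteDist y z)) with h | h
  · have := key (max 1 (siteDist y z)) (max 1 (siteDist x z)) (le_max_left _ _) (le_max_left _ _)
      (by linarith)
    change powerKernel α y z ≤ 2 ^ α * powerKernel α x z at this
    nlinarith
  · have := key (max 1 (siteDist x y)) (max 1 (siteDist x z)) (le_max_left _ _) (le_max_left _ _)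
      (by linarith)
    change powerKernel α x y ≤ 2 ^ α * powerKernel α x z at this
    nlinarith

lemma exists_sum_powerKernel_le (d : ℕ) {α : ℝ} (hα : (d : ℝ) < α) :
    ∃ σ : ℝ, 0 < σ ∧ ∀ (Λ : Finset (Fin d → ℤ)) (x : Λ),
      ∑ y : Λ, powerKernel α (x : Fin d → ℤ) y ≤ σ := by
  obtain ⟨C, hC, h⟩ := exists_tail_sum_le d hα
  -- The `1` is the diagonal term; any cutoff below the minimal distance 1, here `1 / 2`, captures
  -- all other sites.
  refine ⟨1 + C * (1 / 2) ^ ((d : ℝ) - α), by positivity, fun Λ x => ?_⟩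
  rw [Finset.sum_coe_sort Λ (fun y => powerKernel α (x : Fin d → ℤ) y),
    ← Finset.add_sum_erase Λ _ x.2, powerKernel_self]
  gcongr
  refine le_trans ?_ (h x Λ (1 / 2) (by norm_num))
  calc _ = ∑ y ∈ Λ.erase x, siteDist (x : Fin d → ℤ) y ^ (-α) :=
        Finset.sum_congr rfl fun y hy => powerKernel_of_ne α (Finset.ne_of_mem_erase hy).symm
    _ ≤ _ := by
        refine Finset.sum_le_sum_of_subset_of_nonneg (fun y hy => ?_)
          fun y _ _ => Real.rpow_nonneg (siteDist_nonneg _ _) _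
        rw [Finset.mem_filter]
        have := one_le_siteDist (Finset.ne_of_mem_erase hy).symm
        exact ⟨Finset.mem_of_mem_erase hy, by linarith⟩

lemma IsLongRange.isReproducing {Λ : Finset (Fin d → ℤ)} {q : Λ → ℕ} {α : ℝ} (hα : 0 ≤ α)
    {L : Finset Λ → SuperOp q} (hL : IsLongRange α L) {σ : ℝ}
    (hσ : ∀ x : Λ, ∑ y : Λ, powerKernel α (x : Fin d → ℤ) y ≤ σ) :
    IsReproducing L (fun x y => powerKernel α (x : Fin d → ℤ) y) σ (2 ^ α * (2 * σ)) where
  pos i j := powerKernel_pos α _ _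
  diag i := powerKernel_self α _
  coupling i j hij := by
    refine (hL.2 i j hij).trans (le_of_eq ?_)
    rw [powerKernel_of_ne α (fun h => hij (Subtype.ext h)), one_div,
      Real.rpow_neg (siteDist_nonneg _ _)]
  row := hσ
  conv i j := by
    calc _ ≤ ∑ k : Λ, 2 ^ α * powerKernel α (i : Fin d → ℤ) j *
          (powerKernel α (i : Fin d → ℤ) k + powerKernel α (k : Fin d → ℤ) j) :=
          Finset.sum_le_sum fun k _ => powerKernel_mul_le hα _ _ _
      _ = 2 ^ α * powerKernel α (i : Fin d → ℤ) j *
          (∑ k : Λ, powerKernel α (i : Fin d → ℤ) k +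
            ∑ k : Λ, powerKernel α (j : Fin d → ℤ) k) := by
          rw [← Finset.mul_sum, Finset.sum_add_distrib]
          simp only [powerKernel_comm α (j : Fin d → ℤ)]
      _ ≤ 2 ^ α * powerKernel α (i : Fin d → ℤ) j * (σ + σ) := by
          have := powerKernel_pos α (i : Fin d → ℤ) j
          gcongr
          exacts [hσ i, hσ j]
      _ = _ := by ring

end Lattice

/-! ### Layers around `X` and the accumulated leakage -/

section LightCone

variable {d : ℕ}

/-- Counts integers in `[a, b - 1)`; the unit gap absorbs the rounding of both ends. Nonemptiness
excludes a negative `b - a`. -/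
lemma card_filter_range_le {a b : ℝ} {n : ℕ}
    (h : ((Finset.range n).filter fun k : ℕ => a ≤ k ∧ (k : ℝ) + 1 < b).Nonempty) :
    (((Finset.range n).filter fun k : ℕ => a ≤ k ∧ (k : ℝ) + 1 < b).card : ℝ) ≤ b - a := by
  have hb : ∀ k : ℕ, (k : ℝ) + 1 < b → k < ⌈b - 1⌉₊ := fun k hk =>
    Nat.lt_ceil.mpr (by linarith)
  obtain ⟨k, hk⟩ := h
  rw [Finset.mem_filter] at hk
  have h1 : ⌈a⌉₊ ≤ ⌈b - 1⌉₊ := (Nat.ceil_le.mpr hk.2.1).trans (hb k hk.2.2).le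
  have h2 : ((Finset.range n).filter fun k : ℕ => a ≤ k ∧ (k : ℝ) + 1 < b) ⊆
      Finset.Ico ⌈a⌉₊ ⌈b - 1⌉₊ := by
    intro k hk
    rw [Finset.mem_filter] at hk
    exact Finset.mem_Ico.mpr ⟨Nat.ceil_le.mpr hk.2.1, hb k hk.2.2⟩
  have h3 := Finset.card_le_card h2
  rw [Nat.card_Ico] at h3
  have h4 : (⌈b - 1⌉₊ : ℝ) < b - 1 + 1 :=
    Nat.ceil_lt_add_one (by linarith [(Nat.cast_nonneg k : (0 : ℝ) ≤ k)])
  calc _ ≤ ((⌈b - 1⌉₊ - ⌈a⌉₊ : ℕ) : ℝ) := by exact_mod_cast h3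
    _ = (⌈b - 1⌉₊ : ℝ) - ⌈a⌉₊ := Nat.cast_sub h1
    _ ≤ b - a := by linarith [Nat.le_ceil a]

/-- Total leakage through the layers `{ρ ≤ k l}`: a pair of sites at distance `D` straddles at most
`D / l` layers, and none unless `l < D`. -/
lemma sum_layers_le {α C l : ℝ} (hl : 0 < l)
    (hC : ∀ (x : Fin d → ℤ) (T : Finset (Fin d → ℤ)),
      ∑ y ∈ T with l < siteDist x y, siteDist x y ^ (-(α - 1)) ≤ C)
    {Λ : Finset (Fin d → ℤ)} {ρ : Λ → ℝ}
    (hlip : ∀ i j : Λ, ρ j ≤ ρ i + siteDist (i : Fin d → ℤ) j) (n : ℕ) :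
    ∑ k ∈ Finset.range n, ∑ j ∈ (Finset.univ.filter fun i : Λ => ρ i ≤ ((k + 1 : ℕ) : ℝ) * l)ᶜ,
      ∑ i ∈ Finset.univ.filter fun i : Λ => ρ i ≤ (k : ℝ) * l, powerKernel α (j : Fin d → ℤ) i ≤
    ((Finset.univ.filter fun i : Λ => ρ i ≤ n * l).card : ℝ) * (C / l) := by
  -- For a fixed pair, at most `(ρ j - ρ i) / l ≤ D / l` layers are straddled, so the weight
  -- `D^(-α)` becomes `D^(-(α-1)) / l`, uniformly in `n`.
  have hpair : ∀ i j : Λ, ∑ k ∈ Finset.range n,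
      (if ρ i ≤ k * l ∧ ((k + 1 : ℕ) : ℝ) * l < ρ j then powerKernel α (j : Fin d → ℤ) i else 0) ≤
      if ρ i ≤ n * l then if l < siteDist (i : Fin d → ℤ) j then
        siteDist (i : Fin d → ℤ) j ^ (-(α - 1)) / l else 0 else 0 := by
    intro i j
    have hrhs : 0 ≤ if ρ i ≤ n * l then if l < siteDist (i : Fin d → ℤ) j then
        siteDist (i : Fin d → ℤ) j ^ (-(α - 1)) / l else 0 else 0 := by
      split_ifs
      exacts [div_nonneg (Real.rpow_nonneg (siteDist_nonneg _ _) _) hl.le, le_rfl, le_rfl]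
    have hcond : ∀ k : ℕ, (ρ i ≤ k * l ∧ ((k + 1 : ℕ) : ℝ) * l < ρ j) ↔
        (ρ i / l ≤ k ∧ (k : ℝ) + 1 < ρ j / l) := by
      intro k
      rw [div_le_iff₀ hl, lt_div_iff₀ hl]
      push_cast
      rfl
    simp only [hcond]
    rw [← Finset.sum_filter, Finset.sum_const, nsmul_eq_mul]
    rcases ((Finset.range n).filter
      fun k : ℕ => ρ i / l ≤ k ∧ (k : ℝ) + 1 < ρ j / l).eq_empty_or_nonempty with h | h
    · rw [h]
      simpa using hrhs
    have hcard := card_filter_range_le h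
    obtain ⟨k, hk⟩ := h
    rw [Finset.mem_filter, Finset.mem_range, div_le_iff₀ hl, lt_div_iff₀ hl] at hk
    have hkn : (k : ℝ) * l ≤ n * l := by
      have : (k : ℝ) ≤ n := by exact_mod_cast hk.1.le
      gcongr
    have hD : l < siteDist (i : Fin d → ℤ) j := by linarith [hlip i j]
    have hij : (j : Fin d → ℤ) ≠ i := by
      intro h
      rw [h, siteDist_self] at hD
      exact absurd hD hl.not_gt
    have hD0 := hl.trans hD
    rw [if_pos (hk.2.1.trans hkn), if_pos hD, powerKernel_of_ne α hij, siteDist_comm]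
    calc _ ≤ (siteDist (i : Fin d → ℤ) j / l) * siteDist (i : Fin d → ℤ) j ^ (-α) := by
          refine mul_le_mul_of_nonneg_right (hcard.trans ?_) (Real.rpow_nonneg hD0.le _)
          rw [← sub_div]
          exact div_le_div_of_nonneg_right (by linarith [hlip i j]) hl.le
      _ = _ := by
          rw [show -(α - 1) = 1 + -α by ring, Real.rpow_add hD0, Real.rpow_one]
          ring
  calc _ = ∑ k ∈ Finset.range n, ∑ j : Λ, ∑ i : Λ,
        (if ρ i ≤ k * l ∧ ((k + 1 : ℕ) : ℝ) * l < ρ j then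
          powerKernel α (j : Fin d → ℤ) i else 0) := by
        refine Finset.sum_congr rfl fun k _ => ?_
        rw [Finset.compl_filter, Finset.sum_filter]
        refine Finset.sum_congr rfl fun j _ => ?_
        rw [Finset.sum_filter]
        by_cases h : ((k + 1 : ℕ) : ℝ) * l < ρ j
        · simp only [h, not_le.mpr h, not_false_eq_true, and_true, if_true]
        · simp only [h, not_lt.mp h, not_true_eq_false, and_false, if_false,
            Finset.sum_const_zero]
    _ = ∑ i : Λ, ∑ j : Λ, ∑ k ∈ Finset.range n,
        (if ρ i ≤ k * l ∧ ((k + 1 : ℕ) : ℝ) * l < ρ j then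
          powerKernel α (j : Fin d → ℤ) i else 0) := by
        rw [Finset.sum_comm, Finset.sum_comm (s := Finset.univ (α := Λ))
          (t := Finset.univ (α := Λ))]
        refine Finset.sum_congr rfl fun j _ => Finset.sum_comm
    _ ≤ ∑ i : Λ, ∑ j : Λ, if ρ i ≤ n * l then if l < siteDist (i : Fin d → ℤ) j then
        siteDist (i : Fin d → ℤ) j ^ (-(α - 1)) / l else 0 else 0 :=
        Finset.sum_le_sum fun i _ => Finset.sum_le_sum fun j _ => hpair i j
    _ ≤ ∑ i : Λ, if ρ i ≤ n * l then C / l else 0 := by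
        refine Finset.sum_le_sum fun i _ => ?_
        split_ifs with h
        · rw [Finset.sum_coe_sort Λ (fun y => if l < siteDist (i : Fin d → ℤ) y then
            siteDist (i : Fin d → ℤ) y ^ (-(α - 1)) / l else 0), ← Finset.sum_filter,
            ← Finset.sum_div]
          exact div_le_div_of_nonneg_right (hC i Λ) hl.le
        · simp
    _ = _ := by
        rw [← Finset.sum_filter, Finset.sum_const, nsmul_eq_mul]

lemma card_neighborhood_le {Λ : Finset (Fin d → ℤ)} {X : Finset Λ} {m : ℕ} (hXm : X.card ≤ m)
    {r : ℝ} (hr : 1 ≤ r) :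
    ((Finset.univ.filter fun i : Λ => ∃ x ∈ X, siteDist (x : Fin d → ℤ) i ≤ r).card : ℝ) ≤
      2 * m * (3 * r) ^ d := by
  have hsub : (Finset.univ.filter fun i : Λ => ∃ x ∈ X, siteDist (x : Fin d → ℤ) i ≤ r) ⊆
      X.biUnion fun x => Finset.univ.filter fun i : Λ => siteDist (x : Fin d → ℤ) i ≤ r := by
    intro i hi
    simpa using hi
  have hball : ∀ x : Λ, ((Finset.univ.filter fun i : Λ =>
      siteDist (x : Fin d → ℤ) i ≤ r).card : ℝ) ≤ 2 * (3 * r) ^ d := by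
    intro x
    have h1 : (Finset.univ.filter fun i : Λ => siteDist (x : Fin d → ℤ) i ≤ r).map
        (Function.Embedding.subtype _) ⊆ insert (x : Fin d → ℤ)
          (Λ.filter fun y => (x : Fin d → ℤ) ≠ y ∧ siteDist (x : Fin d → ℤ) y ≤ r) := by
      intro y hy
      rw [Finset.mem_map] at hy
      obtain ⟨i, hi, rfl⟩ := hy
      rw [Finset.mem_filter] at hi
      by_cases h : (x : Fin d → ℤ) = i
      · exact Finset.mem_insert.mpr (Or.inl h.symm)
      · exact Finset.mem_insert_of_mem (Finset.mem_filter.mpr ⟨i.2, h, hi.2⟩)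
    have h2 := (Finset.card_le_card h1).trans (Finset.card_insert_le _ _)
    rw [Finset.card_map] at h2
    have h3 := card_punctured_ball_le (x : Fin d → ℤ) Λ (zero_lt_one.trans_le hr)
    have h4 : (1 : ℝ) ≤ (3 * r) ^ d := one_le_pow₀ (by linarith)
    have h5 : ((Finset.univ.filter fun i : Λ => siteDist (x : Fin d → ℤ) i ≤ r).card : ℝ) ≤
      (Λ.filter fun y => (x : Fin d → ℤ) ≠ y ∧ siteDist (x : Fin d → ℤ) y ≤ r).card + 1 := by
      exact_mod_cast h2
    linarith
  calc _ ≤ ((∑ x ∈ X, (Finset.univ.filter fun i : Λ =>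
        siteDist (x : Fin d → ℤ) i ≤ r).card : ℕ) : ℝ) := by
        exact_mod_cast (Finset.card_le_card hsub).trans Finset.card_biUnion_le
    _ ≤ ∑ x ∈ X, 2 * (3 * r) ^ d := by
        push_cast
        exact Finset.sum_le_sum fun x _ => hball x
    _ = X.card * (2 * (3 * r) ^ d) := by rw [Finset.sum_const, nsmul_eq_mul]
    _ ≤ m * (2 * (3 * r) ^ d) := by gcongr
    _ = _ := by ring

/-- After `n` layers of width `r / (2n)` the region stays within `r / 2` of `X`, hence misses `Y`,
and `K` annihilates the final approximant. The region has `O(m r^d)` sites, and the condition on `t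
/ n` makes each slice short enough for the bootstrap. -/
lemma norm_apply_heisenbergEvolution_le_of_layers {Λ : Finset (Fin d → ℤ)} {q : Λ → ℕ}
    (ω : BasisState q) {α σ p C r : ℝ} {m n : ℕ} (hn : 0 < n)
    {L : Finset Λ → SuperOp q} (hL : ∀ Z, IsLiouvillianOn Z (L Z))
    (hF : IsReproducing L (fun x y => powerKernel α (x : Fin d → ℤ) y) σ p)
    {X Y : Finset Λ} (hXm : X.card ≤ m) (hXY : IsSetDist X Y r) (hr : 0 < r)
    (hC : ∀ (x : Fin d → ℤ) (T : Finset (Fin d → ℤ)),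
      ∑ y ∈ T with r / (2 * n) < siteDist x y, siteDist x y ^ (-(α - 1)) ≤ C)
    {A : Obs q} (hA : SupportedOn X A) {K : SuperOp q} (hK : IsLiouvillianOn Y K)
    {t : ℝ} (ht : 0 ≤ t) (htn : 4 * (σ * p * (t / n)) ≤ 1) :
    ‖K (heisenbergEvolution L t A)‖ ≤
      ‖K‖ * (8 * ‖A‖ * (2 * m * (3 * r) ^ d * (C / (r / (2 * n))))) := by
  have hn' : (0 : ℝ) < n := by exact_mod_cast hn
  obtain ⟨⟨x₀, hx₀, y₀, hy₀, hr₀⟩, hmin⟩ := hXY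
  have hr1 : 1 ≤ r := by
    rw [hr₀]
    refine one_le_siteDist fun h => ?_
    rw [hr₀, h, siteDist_self] at hr
    exact lt_irrefl _ hr
  have hX : X.Nonempty := ⟨x₀, hx₀⟩
  set l := r / (2 * n) with hl_def
  have hl : 0 < l := by positivity
  have hnl : n * l = r / 2 := by rw [hl_def]; field_simp
  let ρ : Λ → ℝ := fun i => X.inf' hX fun x => siteDist (x : Fin d → ℤ) i
  have hρ_le : ∀ i, ∀ x ∈ X, ρ i ≤ siteDist (x : Fin d → ℤ) i := fun i x hx =>
    Finset.inf'_le _ hx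
  have hρ_eq : ∀ i, ∃ x ∈ X, ρ i = siteDist (x : Fin d → ℤ) i := fun i =>
    Finset.exists_mem_eq_inf' hX _
  have hlip : ∀ i j : Λ, ρ j ≤ ρ i + siteDist (i : Fin d → ℤ) j := fun i j => by
    obtain ⟨x, hx, h⟩ := hρ_eq i
    rw [h]
    exact (hρ_le j x hx).trans (siteDist_triangle _ _ _)
  let S : ℕ → Finset Λ := fun k => Finset.univ.filter fun i => ρ i ≤ (k : ℝ) * l
  have hXS : ∀ k, X ⊆ S k := fun k x hx => by
    refine Finset.mem_filter.mpr ⟨Finset.mem_univ _, (hρ_le x x hx).trans ?_⟩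
    rw [siteDist_self]
    positivity
  have hYS : Y ⊆ (S n)ᶜ := fun y hy => by
    rw [Finset.mem_compl, Finset.mem_filter, hnl]
    rintro ⟨-, h⟩
    obtain ⟨x, hx, hxy⟩ := hρ_eq y
    have := hmin ⟨x, hx, y, hy, hxy⟩
    linarith
  have hA0 : TrivialOn (S 0)ᶜ A := hA.trivialOn
    (disjoint_compl_right.mono_left (hXS 0))
  obtain ⟨B, hB, -, hAB⟩ := exists_trivialOn_norm_pow_sub_le hF hL ω
    (fun k => hX.mono (hXS k)) hA0 (div_nonneg ht hn'.le) htn n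
  rw [← heisenbergEvolution_nat_mul, mul_div_cancel₀ t hn'.ne'] at hAB
  have hcard : ((Finset.univ.filter fun i : Λ => ρ i ≤ n * l).card : ℝ) ≤
      2 * m * (3 * r) ^ d := by
    refine le_trans ?_ (card_neighborhood_le hXm hr1)
    refine Nat.cast_le.mpr (Finset.card_le_card fun i hi => ?_)
    rw [Finset.mem_filter, hnl] at hi
    obtain ⟨x, hx, h⟩ := hρ_eq i
    exact Finset.mem_filter.mpr ⟨Finset.mem_univ _, x, hx, by linarith [hi.2]⟩
  have hC0 : 0 ≤ C := by simpa using hC x₀ ∅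
  have hsub : K (heisenbergEvolution L t A) = K (heisenbergEvolution L t A - B) := by
    rw [map_sub, hK.apply_eq_zero (hB.anti hYS), sub_zero]
  rw [hsub]
  refine (K.le_opNorm _).trans ?_
  gcongr
  refine hAB.trans ?_
  gcongr
  refine (sum_layers_le hl hC hlip n).trans ?_
  gcongr

end LightCone

/-! ### Choice of the number of slices and conclusion -/

/-- The light-cone bound with an explicit constant for nonempty state spaces and `d ≥ 1`. -/
lemma exists_norm_apply_heisenbergEvolution_le (d : ℕ) (hd : 1 ≤ d) (α : ℝ)
    (hα : 2 * (d : ℝ) < α) (m : ℕ) (t₀ : ℝ) (ht₀ : 0 < t₀) :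
    ∃ C : ℝ, 0 ≤ C ∧ ∀ (Λ : Finset (Fin d → ℤ)) (q : Λ → ℕ) (L : Finset Λ → SuperOp q),
      IsLongRange α L → ∀ (X Y : Finset Λ) (r : ℝ), X.card ≤ m → IsSetDist X Y r → 0 < r →
      ∀ (A : Obs q) (K : SuperOp q), SupportedOn X A → IsLiouvillianOn Y K →
      ∀ t : ℝ, t₀ ≤ t → ‖K (heisenbergEvolution L t A)‖ ≤
        C * ‖K‖ * ‖A‖ * (t ^ (α - (d : ℝ)) / r ^ (α - 2 * (d : ℝ))) := by
  have hd' : (1 : ℝ) ≤ d := by exact_mod_cast hd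
  obtain ⟨σ, hσ0, hσ⟩ := exists_sum_powerKernel_le d (α := α) (by linarith)
  obtain ⟨C, hC0, hC⟩ := exists_tail_sum_le d (β := α - 1) (by linarith)
  set p : ℝ := 2 ^ α * (2 * σ) with hp
  have hp0 : 0 < p := by positivity
  -- The number of slices is a rounded-up multiple of `t`. The term `1 / t₀` absorbs the rounding,
  -- as `1 ≤ t / t₀`, so that `n ≤ b t`; this is where `t ≥ t₀` enters.
  set b : ℝ := 4 * (σ * p) + 1 / t₀ with hb
  have hb0 : 0 < b := by positivity
  refine ⟨8 * (2 * m * 3 ^ d * C) * (2 * b) ^ (α - (d : ℝ)), by positivity, ?_⟩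
  intro Λ q L hL X Y r hXm hXY hr A K hA hK t ht
  have ht0 : 0 < t := ht₀.trans_le ht
  by_cases hq : Nonempty (BasisState q)
  · obtain ⟨ω⟩ := hq
    set n : ℕ := ⌈4 * (σ * p) * t⌉₊ with hn_def
    have hn : 0 < n := Nat.ceil_pos.mpr (by positivity)
    have hn' : (0 : ℝ) < n := by exact_mod_cast hn
    have hn1 : 4 * (σ * p) * t ≤ n := Nat.le_ceil _
    have hn2 : (n : ℝ) ≤ b * t := by
      have h1 : (n : ℝ) < 4 * (σ * p) * t + 1 := Nat.ceil_lt_add_one (by positivity)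
      have h2 : 1 ≤ 1 / t₀ * t := by
        rw [one_div, inv_mul_eq_div]
        exact (one_le_div ht₀).mpr ht
      rw [hb, add_mul]
      linarith
    have htn : 4 * (σ * p * (t / n)) ≤ 1 := by
      have : 4 * (σ * p * (t / n)) = 4 * (σ * p) * t / n := by ring
      rw [this]
      exact (div_le_one hn').mpr hn1
    have hl : 0 < r / (2 * n) := by positivity
    have key := norm_apply_heisenbergEvolution_le_of_layers ω hn hL.1
      (hL.isReproducing (by linarith) (hσ Λ)) hXm hXY hr (fun x T => hC x T _ hl) hA hK ht0.le htn
    refine key.trans ?_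
    -- With `l = r / (2n)`, the tail `l^(d-(α-1))` divided by the layer width is `l^(d-α)`.
    have h1 : C * (r / (2 * n)) ^ ((d : ℝ) - (α - 1)) / (r / (2 * n)) =
        C * (2 * n / r) ^ (α - d) := by
      rw [mul_div_assoc]
      congr 1
      rw [← Real.rpow_sub_one hl.ne', ← inv_div r, Real.inv_rpow hl.le, ← Real.rpow_neg hl.le]
      congr 1
      ring
    have h2 : (2 * n / r : ℝ) ^ (α - d) ≤ (2 * b) ^ (α - (d : ℝ)) * t ^ (α - (d : ℝ)) /
        r ^ (α - (d : ℝ)) := by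
      rw [← Real.mul_rpow (by positivity) ht0.le, ← Real.div_rpow (by positivity) hr.le]
      refine Real.rpow_le_rpow (by positivity) ?_ (by linarith)
      rw [mul_assoc]
      gcongr
    have h3 : r ^ d / r ^ (α - (d : ℝ)) = 1 / r ^ (α - 2 * (d : ℝ)) := by
      rw [← Real.rpow_natCast, ← Real.rpow_sub hr, one_div, ← Real.rpow_neg hr.le]
      congr 1
      ring
    rw [h1, mul_pow]
    calc _ ≤ ‖K‖ * (8 * ‖A‖ * (2 * m * (3 ^ d * r ^ d) * (C * ((2 * b) ^ (α - (d : ℝ)) *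
          t ^ (α - (d : ℝ)) / r ^ (α - (d : ℝ)))))) := by gcongr
      _ = 8 * (2 * m * 3 ^ d * C) * (2 * b) ^ (α - (d : ℝ)) * ‖K‖ * ‖A‖ *
          (t ^ (α - (d : ℝ)) * (r ^ d / r ^ (α - (d : ℝ)))) := by ring
      _ = _ := by rw [h3, mul_one_div]
  -- If some site has no levels, the Hilbert space is zero and so is every observable.
  · have : IsEmpty (BasisState q) := not_nonempty_iff.mp hq
    have h0 : K (heisenbergEvolution L t A) = 0 := Matrix.ext fun s => isEmptyElim s
    rw [h0, norm_zero]
    positivity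

theorem mainTheorem5 (d : ℕ) (α : ℝ) (hα : 2 * (d : ℝ) < α)
    (m : ℕ) (t₀ : ℝ) (ht₀ : 0 < t₀) :
    ∃ (C : ℝ) (c : ℝ → ℝ), 0 < C ∧ (∀ ε : ℝ, 0 < ε → 0 < c ε) ∧
      ∀ (Λ : Finset (Fin d → ℤ)) (q : Λ → ℕ) (L : Finset Λ → SuperOp q), IsLongRange α L →
      ∀ (X Y : Finset Λ) (r : ℝ), X.card ≤ m → IsSetDist X Y r → 0 < r →
      ∀ (A : Obs q) (K : SuperOp q), SupportedOn X A → IsLiouvillianOn Y K →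
      ∀ t : ℝ, t₀ ≤ t →
        ‖K (heisenbergEvolution L t A)‖ ≤
            C * ‖K‖ * ‖A‖ * (t ^ (α - (d : ℝ)) / r ^ (α - 2 * (d : ℝ))) ∧
        ∀ ε : ℝ, 0 < ε → t ≤ c ε * r ^ ((α - 2 * (d : ℝ)) / (α - (d : ℝ))) →
          ‖K (heisenbergEvolution L t A)‖ ≤ ε * ‖K‖ * ‖A‖ := by
  rcases Nat.eq_zero_or_pos d with rfl | hd
  -- In dimension 0 there is only one site, so no two sets are at positive distance.
  · refine ⟨1, fun _ => 1, one_pos, fun _ _ => one_pos, ?_⟩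
    intro Λ q L _ X Y r _ hXY hr
    obtain ⟨x, -, y, -, h⟩ := hXY.1
    rw [h, Subsingleton.elim (x : Fin 0 → ℤ) y, siteDist_self] at hr
    exact absurd hr (lt_irrefl _)
  obtain ⟨C, hC0, hC⟩ := exists_norm_apply_heisenbergEvolution_le d hd α hα m t₀ ht₀
  have hd0 : (0 : ℝ) ≤ d := Nat.cast_nonneg d
  have hαd : 0 < α - (d : ℝ) := by linarith
  have hC1 : 0 < C + 1 := by linarith
  -- `C` is only known to be nonnegative, hence `C + 1`. The value of `c ε` solves `(C + 1) c^(α-d)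
  -- = ε`.
  refine ⟨C + 1, fun ε => (ε / (C + 1)) ^ (α - (d : ℝ))⁻¹, hC1,
    fun ε hε => by positivity, ?_⟩
  intro Λ q L hL X Y r hXm hXY hr A K hA hK t ht
  have ht0 : 0 < t := ht₀.trans_le ht
  have h1 : ‖K (heisenbergEvolution L t A)‖ ≤
      (C + 1) * ‖K‖ * ‖A‖ * (t ^ (α - (d : ℝ)) / r ^ (α - 2 * (d : ℝ))) := by
    refine (hC Λ q L hL X Y r hXm hXY hr A K hA hK t ht).trans ?_
    gcongr
    linarith
  refine ⟨h1, fun ε hε hte => h1.trans ?_⟩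
  have h2 : t ^ (α - (d : ℝ)) ≤ ε / (C + 1) * r ^ (α - 2 * (d : ℝ)) := by
    refine (Real.rpow_le_rpow ht0.le hte hαd.le).trans (le_of_eq ?_)
    rw [Real.mul_rpow (by positivity) (by positivity), ← Real.rpow_mul (by positivity),
      ← Real.rpow_mul hr.le, inv_mul_cancel₀ hαd.ne', Real.rpow_one, div_mul_cancel₀ _ hαd.ne']
  have h3 : t ^ (α - (d : ℝ)) / r ^ (α - 2 * (d : ℝ)) ≤ ε / (C + 1) :=
    (div_le_iff₀ (by positivity)).mpr h2
  calc _ ≤ (C + 1) * ‖K‖ * ‖A‖ * (ε / (C + 1)) := by gcongr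
    _ = ε * ‖K‖ * ‖A‖ := by field_simp
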